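/- **Setting.** Let $\Gamma=(E,V,l,i,j)$ be a countable, infinite, connected metric graph without isolated vertices (loops and multiple edges allowed), whose edge lengths satisfy $0<u\le l(e)\le U<\infty$ for all $e\in E$; the edge $e$ is identified with $I_e=(0,l(e))$, starting at $i(e)$ and ending at $j(e)$. For $v\in V$ and $r>0$ let $E(v,r)$ be the set of edges that meet the open ball $B_r(v)$ of the path metric, and let $\Lambda_r(v)$ be the subgraph induced by $E(v,r)$. Assume uniform polynomial growth of degree $d\in\mathbb R$: there is a constant $C$ with $\sum_{e\in E(v,r)} l(e)\le C r^d$ for all $v\in V$ and $r\ge u$. Let $E_v$ be the set of edge ends at $v$. A boundary condition is a family $(P_v,L_v)_{v\in V}$ of orthogonal projections $P_v$ of $\ell^2(E_v)$ and self-adjoint operators $L_v$ in $(1-P_v)\ell^2(E_v)$ with $L_v\ge -S$ for some $S>0$ independent of $v$. For $f$ on the edges let $\mathrm{tr}_v f=(f_e(t))_{(e,t)\in E_v}$ be the vector of boundary values, and let $\mathrm{str}_v f'$ be the vector of boundary values of $f'$ with sign $+1$ at $t=0$ and $-1$ at $t=l(e)$. Let $\mu$ be a probability measure on $\mathbb R$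 with a bounded density and support $[q_-,q_+]$, $q_-<q_+$; let $\Omega=[q_-,q_+]^E$ with the product measure $\mathbb P=\bigotimes_{e\in E}\mu$; let $0<c_-\le c_+$ and let $\nu_e:I_e\to\mathbb R$ be measurable with $c_-\le\nu_e\le c_+$ for all $e\in E$. For $A\subset E$ and $\omega\in\Omega$ let $H^{A}(\omega)$ be the operator $f\mapsto(-f_e''+\omega_e\nu_e f_e)_{e\in A}$ in $\bigoplus_{e\in A}L^2(I_e)$ whose domain consists of all $f\in\bigoplus_{e\in A}W^{2,2}(I_e)$ such that $\mathrm{tr}_vf\in\mathrm{dom}(L_v)$ and $L_v\mathrm{tr}_vf=(1-P_v)\,\mathrm{str}_vf'$ at every vertex $v$ all of whose incident edges lie in $A$, and such that $f$ has boundary values $0$ at every vertex that is incident both to an edge in $A$ and to an edge not in $A$. Write $H^{\Lambda_r(v)}(\omega)=H^{E(v,r)}(\omega)$. Let $\lambda_0$ be the lower bound of the operator on the whole graph ($A=E$) with $\omega_e=q_-$ for all $e$, that is, the greatest $c\in\mathbb{R}$ with $\langle Hf,f\rangle\ge c\|f\|^2$ on its domain. Assume the disorder condition: $\tau>\tfrac{3d}{2}-1$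 and $\mu([q_-,q_-+h])\le h^\tau$ for all sufficiently small $h>0$. **Theorem (Initial length scale estimate).** For each $\xi\in(0,2\tau-d)$ there exist $\beta>0$, depending only on $d$, $\tau$ and $\xi$, and a radius $r_1\ge 300\,U$ such that for all $v\in V$ and all $r\ge r_1$ $$\mathbb P\bigl\{\omega\in\Omega:\ \mathrm{dist}\bigl(\sigma(H^{\Lambda_r(v)}(\omega)),\{\lambda_0\}\bigr)\le r^{\beta-2}\bigr\}\le r^{-\xi}.$$ -/

import Mathlib

open MeasureTheory Filter Topology
open scoped ENNReal InnerProductSpace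

noncomputable section

namespace QGraph

/-! ### Metric graphs -/

/-- A metric graph with edges `E`, vertices `V` and finite edge lengths: every edge `e` is
identified with the interval `(0, len e)`, starts in `src e` and ends in `tgt e`.
Loops and multiple edges are allowed. -/
structure MetricGraph (E V : Type*) where
  len : E → ℝ
  len_pos : ∀ e, 0 < len e
  src : E → V
  tgt : E → V

namespace MetricGraph

variable {E V : Type*} (G : MetricGraph E V)

/-- The end `(e, false)` of `e` is its starting point and `(e, true)` its end point. -/
def endVertex (p : E × Bool) : V := if p.2 then G.tgt p.1 else G.src p.1

/-- The coordinate of an edge end in `[0, len e]`. -/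
def endCoord (p : E × Bool) : ℝ := if p.2 then G.len p.1 else 0

/-- The set `E_v` of edge ends at the vertex `v`; a loop contributes both of its ends. -/
abbrev Ends (v : V) : Type _ := {p : E × Bool // G.endVertex p = v}

/-- The points of the metric space `X_Γ`: vertices and interior points of edges. -/
inductive Point : Type _
  | vertex (v : V) : Point
  | inner (e : E) (t : Set.Ioo 0 (G.len e)) : Point

/-- The point with coordinate `t ∈ [0, len e]` on the closed edge `e`. -/
def pt (e : E) (t : ℝ) : G.Point :=
  if h : t ∈ Set.Ioo 0 (G.len e) then .inner e ⟨t, h⟩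
  else if t ≤ 0 then .vertex (G.src e) else .vertex (G.tgt e)

/-- `G.IsPath x y a`: there is a path of length `a` from `x` to `y`, that is, a finite
concatenation of segments of closed edges whose lengths add up to `a`. -/
inductive IsPath : G.Point → G.Point → ℝ → Prop
  | nil (x : G.Point) : IsPath x x 0
  | cons (e : E) (s t : ℝ) (hs : s ∈ Set.Icc 0 (G.len e)) (ht : t ∈ Set.Icc 0 (G.len e))
      (y : G.Point) (a : ℝ) (h : IsPath (G.pt e t) y a) : IsPath (G.pt e s) y (|s - t| + a)

/-- The path metric on `X_Γ` (for connected graphs). -/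
def pathDist (x y : G.Point) : ℝ := sInf {a | G.IsPath x y a}

/-- Any two points are joined by a path. -/
def Connected : Prop := ∀ x y : G.Point, ∃ a, G.IsPath x y a

/-- Every vertex is incident to some edge. -/
def NoIsolated : Prop := ∀ v, Nonempty (G.Ends v)

/-- The edge set `E(v, r)` of the ball `Λ_r(v)`: the edges that meet the open ball `B_r(v)`. -/
def ballEdges (v : V) (r : ℝ) : Set E :=
  {e | ∃ t : Set.Ioo 0 (G.len e), G.pathDist (.inner e t) (.vertex v) < r}

/-- The volume of the subgraph induced by `A`, the sum of its edge lengths. -/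
def vol (A : Set E) : ℝ≥0∞ := ∑' e : A, ENNReal.ofReal (G.len e)

/-- Edge lengths uniformly bounded from below by `u > 0` and from above by `U < ∞`. -/
def LengthBounds (u U : ℝ) : Prop := 0 < u ∧ u ≤ U ∧ ∀ e, u ≤ G.len e ∧ G.len e ≤ U

/-- Uniform polynomial growth of degree `d` with constant `C` (for radii `r ≥ u`). -/
def PolyGrowth (u C d : ℝ) : Prop :=
  ∀ v, ∀ r : ℝ, u ≤ r → G.vol (G.ballEdges v r) ≤ ENNReal.ofReal (C * r ^ d)

/-- Inner vertices of the subgraph induced by `A`: all incident edges belong to `A`. -/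
def IsInner (A : Set E) (v : V) : Prop := ∀ p : E × Bool, G.endVertex p = v → p.1 ∈ A

/-- Boundary vertices of the subgraph induced by `A`: some incident edge belongs to `A` and
some other one does not. -/
def IsBoundary (A : Set E) (v : V) : Prop :=
  (∃ p : E × Bool, G.endVertex p = v ∧ p.1 ∈ A) ∧ ∃ p : E × Bool, G.endVertex p = v ∧ p.1 ∉ A

/-! ### Function spaces -/

/-- Lebesgue measure on the edge `I_e = (0, len e)`. -/
abbrev edgeMeasure (e : E) : Measure ℝ := volume.restrict (Set.Ioo 0 (G.len e))

/-- The Hilbert space `L²(X_A) = ⨁_{e ∈ A} L²(I_e)`. -/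
abbrev L2 (A : Set E) : Type _ := lp (fun e : A => Lp ℂ 2 (G.edgeMeasure e)) 2

/-- The Hilbert space `ℓ²(E_v)`. -/
abbrev VertexSpace (v : V) : Type _ := lp (fun _ : G.Ends v => ℂ) 2

end MetricGraph

/-- `g` is the weak derivative of `f` on `(0, l)`. -/
def IsWeakDeriv (l : ℝ) (f g : ℝ → ℂ) : Prop :=
  ∀ φ : ℝ → ℝ, ContDiff ℝ ((⊤ : ℕ∞) : WithTop ℕ∞) φ → HasCompactSupport φ → tsupport φ ⊆ Set.Ioo 0 l →
    ∫ t in Set.Ioo 0 l, deriv φ t • f t = -∫ t in Set.Ioo 0 l, φ t • g t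

/-- `c` is the boundary value of `f` at the end point `a` of `(0, l)`: the limit along `(0, l)`
up to null sets. It does not depend on the representative of `f`, and it is the limit of the
continuous representative if there is one. -/
def HasBoundaryValue (l : ℝ) (f : ℝ → ℂ) (a : ℝ) (c : ℂ) : Prop :=
  Tendsto f (𝓝[Set.Ioo 0 l] a ⊓ ae volume) (𝓝 c)

/-! ### Boundary conditions -/

variable {E V : Type*}

/-- A boundary condition `(P, L)`: for every vertex `v` an orthogonal projection `P v` of `ℓ²(E_v)`
and a (possibly unbounded) self-adjoint operator `L v` in the Hilbert space
`(1 - P v) ℓ²(E_v) = ker (P v)`, with the uniform lower bound `L v ≥ -S`. -/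
structure BoundaryCondition (G : MetricGraph E V) where
  P : ∀ v, G.VertexSpace v →L[ℂ] G.VertexSpace v
  isStarProjection : ∀ v, IsStarProjection (P v)
  L : ∀ v, (P v).ker →ₗ.[ℂ] (P v).ker
  isSelfAdjoint : ∀ v, IsSelfAdjoint (L v)
  S : ℝ
  S_pos : 0 < S
  lower_bound : ∀ v, ∀ x : (L v).domain,
    -S * ‖(x : (P v).ker)‖ ^ 2 ≤ (⟪L v x, (x : (P v).ker)⟫_ℂ).re

/-- The boundary condition at `v` for the vector `x` of boundary values and the vector `y` of
signed boundary values of the derivative: `x ∈ dom (L v)` and `L v x = (1 - P v) y`. -/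
def BoundaryCondition.Holds {G : MetricGraph E V} (bc : BoundaryCondition G) (v : V)
    (x y : G.VertexSpace v) : Prop :=
  ∃ z : (bc.L v).domain, ((z : (bc.P v).ker) : G.VertexSpace v) = x ∧
    ((bc.L v z : (bc.P v).ker) : G.VertexSpace v) = y - bc.P v y

/-! ### Operators -/

/-- The sign of an edge end in the signed trace. -/
def endSign (p : E × Bool) : ℂ := if p.2 then -1 else 1

/-- `x` is the vector of boundary values `tr_v f` of `f` at `v`, taken over the ends at `v` of the
edges that belong to `A` (all ends, if `v` is an inner vertex). -/
def IsTrace (G : MetricGraph E V) {A : Set E} (f : G.L2 A) (v : V) (x : G.VertexSpace v) : Prop :=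
  ∀ p : G.Ends v, ∀ hp : p.1.1 ∈ A,
    HasBoundaryValue (G.len p.1.1) (f ⟨p.1.1, hp⟩) (G.endCoord p.1) (x p)

/-- `y` is the signed trace `str_v f`, in the same sense. -/
def IsSignedTrace (G : MetricGraph E V) {A : Set E} (f : G.L2 A) (v : V) (y : G.VertexSpace v) :
    Prop :=
  ∀ p : G.Ends v, ∀ hp : p.1.1 ∈ A,
    HasBoundaryValue (G.len p.1.1) (f ⟨p.1.1, hp⟩) (G.endCoord p.1) (endSign p.1 * y p)

/-- `f ∈ W^{2,2}(X_A)` with `f' = f₁` and `f'' = f₂`, all three in `L²(X_A)`. -/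
def IsSobolev2 (G : MetricGraph E V) {A : Set E} (f f₁ f₂ : G.L2 A) : Prop :=
  ∀ e : A, IsWeakDeriv (G.len e) (f e) (f₁ e) ∧ IsWeakDeriv (G.len e) (f₁ e) (f₂ e)

/-- The graph `{(f, H f)}` of the operator `H f = -f'' + (q_e ν_e f_e)_e` in `L²(X_A)` on the
subgraph induced by `A`: its domain consists of the `f ∈ W^{2,2}(X_A)` that satisfy the boundary
condition `(P_v, L_v)` at all inner vertices and have boundary values zero at all boundary
vertices of the subgraph. For `A = Set.univ` there are no boundary vertices, and this is the
operator on the whole graph. -/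
def operatorGraph (G : MetricGraph E V) (bc : BoundaryCondition G) (ν : E → ℝ → ℝ) (q : E → ℝ)
    (A : Set E) : Set (G.L2 A × G.L2 A) :=
  {fg | ∃ f₁ f₂ : G.L2 A, IsSobolev2 G fg.1 f₁ f₂ ∧
    (∀ v, G.IsInner A v → ∃ x y : G.VertexSpace v,
      IsTrace G fg.1 v x ∧ IsSignedTrace G f₁ v y ∧ bc.Holds v x y) ∧
    (∀ v, G.IsBoundary A v → IsTrace G fg.1 v 0) ∧
    ∀ e : A, ∀ᵐ t ∂(G.edgeMeasure e),
      (fg.2 e : ℝ → ℂ) t = -(f₂ e : ℝ → ℂ) t + ((q e * ν e t : ℝ) : ℂ) * (fg.1 e : ℝ → ℂ) t}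

section Abstract

variable {H : Type*} [NormedAddCommGroup H] [InnerProductSpace ℂ H]

/-- The spectrum of the operator with graph `T`: the set of all `z` for which `T - z` has no
bounded everywhere defined two-sided inverse `R`. -/
def opSpectrum (T : Set (H × H)) : Set ℂ :=
  {z | ¬ ∃ R : H →L[ℂ] H,
    (∀ k, (R k, k + z • R k) ∈ T) ∧ ∀ f g, (f, g) ∈ T → R (g - z • f) = f}

/-- The lower bound of the operator with graph `T`: the greatest `c` with
`⟨T f, f⟩ ≥ c ‖f‖²` for all `f` in the domain. -/
def lowerBound (T : Set (H × H)) : ℝ :=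
  sInf {c | ∃ f g, (f, g) ∈ T ∧ ‖f‖ = 1 ∧ c = (⟪f, g⟫_ℂ).re}

end Abstract

/-- The lower bound `λ₀` of `H^{P,L} + (q₋ ν_e)_e`, an operator on the whole graph. -/
def groundEnergy (G : MetricGraph E V) (bc : BoundaryCondition G) (ν : E → ℝ → ℝ) (qm : ℝ) : ℝ :=
  lowerBound (operatorGraph G bc ν (fun _ => qm) Set.univ)

/-- The spectrum of the restriction `H^{Λ_r(v)}(ω)` of the random operator to a ball. -/
def ballSpectrum (G : MetricGraph E V) (bc : BoundaryCondition G) (ν : E → ℝ → ℝ) (ω : E → ℝ)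
    (v : V) (r : ℝ) : Set ℂ :=
  opSpectrum (operatorGraph G bc ν ω (G.ballEdges v r))

/-! ### The random potential -/

/-- The distribution `μ` of the coupling constants has support `[qm, qp]`, `qm < qp`, and a
bounded density. -/
def HasBoundedDensity (μ : Measure ℝ) (qm qp : ℝ) : Prop :=
  qm < qp ∧ μ.support = Set.Icc qm qp ∧
    ∃ ρ : ℝ → ℝ≥0∞, Measurable ρ ∧ (∃ c : ℝ, ∀ᵐ t, ρ t ≤ ENNReal.ofReal c) ∧
      μ = volume.withDensity ρ

/-- The single site potentials satisfy `0 < cm ≤ ν_e ≤ cp` on all edges. -/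
def IsSingleSite (G : MetricGraph E V) (ν : E → ℝ → ℝ) (cm cp : ℝ) : Prop :=
  0 < cm ∧ cm ≤ cp ∧ ∀ e, AEStronglyMeasurable (ν e) (G.edgeMeasure e) ∧
    ∀ᵐ t ∂(G.edgeMeasure e), cm ≤ ν e t ∧ ν e t ≤ cp

/-- The disorder condition: `τ > 3d/2 - 1`, and `μ [qm, qm + h] ≤ h ^ τ` for small `h > 0`. -/
def Disorder (μ : Measure ℝ) (qm d τ : ℝ) : Prop :=
  3 * d / 2 - 1 < τ ∧ ∀ᶠ h in 𝓝[>] (0 : ℝ), μ (Set.Icc qm (qm + h)) ≤ ENNReal.ofReal (h ^ τ)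

end QGraph

end

noncomputable section

namespace QGraph

/-! ### Absolutely continuous functions on an interval -/

/-! If every coupling constant on the ball is at least `qm + h`, then the potential there exceeds
the one with constant coupling `qm` by at least `cm * h`, so the spectrum of the ball operator
should lie above `λ₀ + cm * h`. With `h = (2 / cm) * r ^ (β - 2)` this keeps the spectrum at
distance at least `2 * r ^ (β - 2)` from `λ₀`. The bad event therefore forces some edge of the ball
to have a coupling constant in `[qm, qm + h]` (`exists_coupling_le_of_infEDist_le`). The ball has at
most `C * r ^ d / u` edges, and each is bad with probability at most `h ^ τ`. By the union bound
(`measure_exists_coupling_le`) the bad event has probability at most a constant times `r ^ (d + (β -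
2) * τ)`, which is below `r ^ (-ξ)` for large `r` as soon as `τ * β < 2 * τ - d - ξ`
(`eventually_rpow_bound`).

Two facts of operator theory carry this. The first is that the quadratic form on a finite subgraph
with coupling `qm` is bounded below by `λ₀` (`groundEnergy_mul_le_of_finite`). Extension by zero
would give this at once if it preserved the domain, but a function vanishing at a boundary vertex
may have a nonzero derivative there, which the condition `(P, L)` of the whole graph need not allow.
`IsRep.exists_approximation` removes these derivatives by a correction on strips of width `ε` whose
norm and contribution to the form are `O(ε)`; then `ε` tends to zero.

The second is that the spectrum, defined by the failure of bounded invertibility, lies above every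
lower bound of the form (`notMem_opSpectrum_operatorGraph`). A lower bound gives injectivity and a
resolvent estimate; surjectivity has to be proved. Without potential and far below zero, the
equation is solved explicitly on every edge, and the boundary conditions become a square linear
system that is injective by semiboundedness (`exists_mem_operatorGraph_zero`). Neumann series then
add the potential and move the spectral parameter. Semiboundedness itself
(`operatorGraph_re_inner_ge`) comes from Green's formula and the trace inequality on an edge. -/

/-- `w` is a primitive on `[0, l]` of the integrable function `k`. -/
def IsPrim (l : ℝ) (w k : ℝ → ℂ) : Prop :=
  IntegrableOn k (Set.Ioo 0 l) ∧ ∀ t ∈ Set.Icc 0 l, w t = w 0 + ∫ s in (0 : ℝ)..t, k s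

section IsPrim

variable {l : ℝ} {u u' w w' k : ℝ → ℂ}

theorem intervalIntegrable_of_integrableOn_Ioo (hk : IntegrableOn k (Set.Ioo 0 l)) {s t : ℝ}
    (hs : s ∈ Set.Icc 0 l) (ht : t ∈ Set.Icc 0 l) : IntervalIntegrable k volume s t := by
  have h1 : IntegrableOn k (Set.Icc 0 l) := (integrableOn_Icc_iff_integrableOn_Ioo).2 hk
  exact (h1.mono_set (Set.uIcc_subset_Icc hs ht)).intervalIntegrable

theorem IsPrim.intervalIntegrable (h : IsPrim l w k) {s t : ℝ}
    (hs : s ∈ Set.Icc 0 l) (ht : t ∈ Set.Icc 0 l) : IntervalIntegrable k volume s t :=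
  intervalIntegrable_of_integrableOn_Ioo h.1 hs ht

theorem IsPrim.integral_eq (h : IsPrim l w k) (hl : 0 ≤ l) :
    ∫ s in (0 : ℝ)..l, k s = w l - w 0 := by
  rw [h.2 l ⟨hl, le_rfl⟩]; ring

theorem IsPrim.continuousOn (h : IsPrim l w k) (hl : 0 ≤ l) : ContinuousOn w (Set.Icc 0 l) := by
  have h1 : ContinuousOn (fun t => w 0 + ∫ s in (0 : ℝ)..t, k s) (Set.Icc 0 l) := by
    refine continuousOn_const.add ?_
    have := intervalIntegral.continuousOn_primitive_interval' (μ := volume) (f := k) (a := 0)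
      (b₁ := 0) (b₂ := l) (h.intervalIntegrable ⟨le_rfl, hl⟩ ⟨hl, le_rfl⟩) (by simp)
    rwa [Set.uIcc_of_le hl] at this
  exact h1.congr h.2

theorem isPrim_primitive (hk : IntegrableOn k (Set.Ioo 0 l)) (c : ℂ) :
    IsPrim l (fun t => c + ∫ s in (0 : ℝ)..t, k s) k :=
  ⟨hk, fun t _ => by simp⟩

theorem IsPrim.add (hu : IsPrim l u u') (hw : IsPrim l w w') :
    IsPrim l (fun t => u t + w t) (fun t => u' t + w' t) := by
  refine ⟨hu.1.add hw.1, fun t ht => ?_⟩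
  have h0 : (0 : ℝ) ∈ Set.Icc 0 l := ⟨le_rfl, ht.1.trans ht.2⟩
  beta_reduce
  rw [intervalIntegral.integral_add (hu.intervalIntegrable h0 ht) (hw.intervalIntegrable h0 ht),
    hu.2 t ht, hw.2 t ht]
  ring

theorem IsPrim.const_mul (hw : IsPrim l w w') (c : ℂ) :
    IsPrim l (fun t => c * w t) (fun t => c * w' t) := by
  refine ⟨hw.1.const_mul c, fun t ht => ?_⟩
  beta_reduce
  rw [intervalIntegral.integral_const_mul, hw.2 t ht]
  ring

theorem IsPrim.neg (hw : IsPrim l w w') : IsPrim l (fun t => -w t) (fun t => -w' t) := by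
  simpa using hw.const_mul (-1)

theorem IsPrim.sub (hu : IsPrim l u u') (hw : IsPrim l w w') :
    IsPrim l (fun t => u t - w t) (fun t => u' t - w' t) := by
  simpa [sub_eq_add_neg] using hu.add hw.neg

theorem IsPrim.conj (hw : IsPrim l w w') :
    IsPrim l (fun t => starRingEnd ℂ (w t)) (fun t => starRingEnd ℂ (w' t)) := by
  refine ⟨(Complex.conjLIE.toContinuousLinearEquiv.toContinuousLinearMap).integrable_comp hw.1,
    fun t ht => ?_⟩
  beta_reduce
  rw [hw.2 t ht, map_add, intervalIntegral.integral_of_le ht.1,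
    intervalIntegral.integral_of_le ht.1, integral_conj]

theorem IsPrim.congr_deriv (hw : IsPrim l w w')
    (h : ∀ᵐ t ∂(volume.restrict (Set.Ioo 0 l)), w' t = k t) : IsPrim l w k := by
  refine ⟨hw.1.congr h, fun t ht => ?_⟩
  rw [hw.2 t ht]
  congr 1
  rw [intervalIntegral.integral_of_le ht.1, intervalIntegral.integral_of_le ht.1,
    integral_Ioc_eq_integral_Ioo, integral_Ioc_eq_integral_Ioo]
  exact integral_congr_ae (ae_restrict_of_ae_restrict_of_subset
    (Set.Ioo_subset_Ioo_right ht.2) h)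

theorem isPrim_of_hasDerivAt (h : ∀ t ∈ Set.Icc 0 l, HasDerivAt w (w' t) t)
    (hc : ContinuousOn w' (Set.Icc 0 l)) : IsPrim l w w' := by
  refine ⟨(hc.integrableOn_Icc).mono_set Set.Ioo_subset_Icc_self, fun t ht => ?_⟩
  have hsub : Set.uIcc 0 t ⊆ Set.Icc 0 l := by
    rw [Set.uIcc_of_le ht.1]; exact Set.Icc_subset_Icc_right ht.2
  rw [intervalIntegral.integral_eq_sub_of_hasDerivAt (fun x hx => h x (hsub hx))
    ((hc.mono hsub).intervalIntegrable)]
  ring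

theorem isPrim_const (c : ℂ) : IsPrim l (fun _ => c) (fun _ => 0) :=
  isPrim_of_hasDerivAt (fun t _ => hasDerivAt_const t c) continuousOn_const

/-- Fubini on the square `(0, l]²`, cut along the diagonal into two triangles. This is the product
rule for primitives vanishing at `0`. -/
theorem integral_mul_integral_eq (hu : IntegrableOn u' (Set.Ioc 0 l))
    (hw : IntegrableOn w' (Set.Ioc 0 l)) :
    (∫ s in Set.Ioc 0 l, u' s) * (∫ s in Set.Ioc 0 l, w' s) =
      (∫ s in Set.Ioc 0 l, u' s * ∫ r in Set.Ioc 0 s, w' r) +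
        ∫ s in Set.Ioc 0 l, w' s * ∫ r in Set.Ioc 0 s, u' r := by
  set μ := volume.restrict (Set.Ioc 0 l) with hμ
  have hp : Integrable (fun z : ℝ × ℝ => u' z.1 * w' z.2) (μ.prod μ) := hu.mul_prod hw
  have hm : MeasurableSet {z : ℝ × ℝ | z.2 ≤ z.1} := measurableSet_le measurable_snd measurable_fst
  rw [← integral_prod_mul (μ := μ) (ν := μ), ← integral_add_compl hm hp]
  congr 1
  · rw [← integral_indicator hm, integral_prod _ (hp.indicator hm)]
    refine setIntegral_congr_fun measurableSet_Ioc fun s hs => ?_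
    rw [← integral_const_mul, ← integral_indicator measurableSet_Ioc,
      ← integral_indicator measurableSet_Ioc]
    refine integral_congr_ae (Eventually.of_forall fun r => ?_)
    simp only [Set.indicator, Set.mem_ofPred_eq, Set.mem_Ioc]
    have := hs.2
    split_ifs <;> first | rfl | (exfalso; grind)
  · rw [← integral_indicator hm.compl, integral_prod_symm _ (hp.indicator hm.compl)]
    refine setIntegral_congr_fun measurableSet_Ioc fun s hs => ?_
    -- The complement of the closed lower triangle is the strict upper one, so the inner integral
    -- omits the endpoint, a null set.
    have h1 : ∫ r in Set.Ioc 0 s, u' r = ∫ r in Set.Ioo 0 s, u' r := integral_Ioc_eq_integral_Ioo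
    rw [h1, ← integral_const_mul, ← integral_indicator measurableSet_Ioc,
      ← integral_indicator measurableSet_Ioo]
    refine integral_congr_ae (Eventually.of_forall fun r => ?_)
    simp only [Set.indicator, Set.mem_ofPred_eq, Set.mem_Ioc, Set.mem_Ioo, Set.mem_compl_iff]
    have := hs.2
    split_ifs <;> first | rfl | exact mul_comm _ _ | (exfalso; grind)

/-- The product rule for absolutely continuous functions. -/
theorem IsPrim.mul (hu : IsPrim l u u') (hw : IsPrim l w w') :
    IsPrim l (fun t => u t * w t) (fun t => u' t * w t + u t * w' t) := by
  rcases lt_or_ge l 0 with hl | hl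
  · exact ⟨by simp [Set.Ioo_eq_empty (not_lt.2 hl.le)], fun t ht => absurd (ht.1.trans ht.2) hl.not_ge⟩
  have hI : ∀ {a b : ℝ → ℂ}, IntegrableOn a (Set.Ioo 0 l) → ContinuousOn b (Set.Icc 0 l) →
      IntegrableOn (fun t => a t * b t) (Set.Ioo 0 l) := by
    intro a b ha hb
    rw [← integrableOn_Icc_iff_integrableOn_Ioo] at ha ⊢
    exact ha.mul_continuousOn hb isCompact_Icc
  have i1 := hI hu.1 (hw.continuousOn hl)
  have i2 : IntegrableOn (fun t => u t * w' t) (Set.Ioo 0 l) := by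
    simpa only [mul_comm] using hI hw.1 (hu.continuousOn hl)
  refine ⟨i1.add i2, fun t ht => ?_⟩
  have h0 : (0 : ℝ) ∈ Set.Icc 0 l := ⟨le_rfl, hl⟩
  have ku := hu.intervalIntegrable h0 ht
  have kw := hw.intervalIntegrable h0 ht
  rw [intervalIntegral.integral_add (intervalIntegrable_of_integrableOn_Ioo i1 h0 ht)
    (intervalIntegrable_of_integrableOn_Ioo i2 h0 ht)]
  -- Once each factor is written as its initial value plus an integral, the initial values
  -- contribute linear terms and what remains is exactly this triangle identity.
  have key := integral_mul_integral_eq ku.1 kw.1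
  have e1 : ∫ s in (0 : ℝ)..t, u' s * w s = w 0 * (∫ s in Set.Ioc 0 t, u' s) +
      ∫ s in Set.Ioc 0 t, u' s * ∫ r in Set.Ioc 0 s, w' r := by
    have : ∀ s ∈ Set.uIcc 0 t, u' s * w s =
        w 0 * u' s + (u' s * w s - w 0 * u' s) := fun s _ => by ring
    rw [intervalIntegral.integral_congr this, intervalIntegral.integral_add (ku.const_mul _)
      ((intervalIntegrable_of_integrableOn_Ioo i1 h0 ht).sub (ku.const_mul _)),
      intervalIntegral.integral_const_mul, intervalIntegral.integral_of_le ht.1,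
      intervalIntegral.integral_of_le ht.1]
    congr 1
    refine setIntegral_congr_fun measurableSet_Ioc fun s hs => ?_
    rw [hw.2 s ⟨hs.1.le, hs.2.trans ht.2⟩, intervalIntegral.integral_of_le hs.1.le]
    ring
  have e2 : ∫ s in (0 : ℝ)..t, u s * w' s = u 0 * (∫ s in Set.Ioc 0 t, w' s) +
      ∫ s in Set.Ioc 0 t, w' s * ∫ r in Set.Ioc 0 s, u' r := by
    have : ∀ s ∈ Set.uIcc 0 t, u s * w' s =
        u 0 * w' s + (u s * w' s - u 0 * w' s) := fun s _ => by ring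
    rw [intervalIntegral.integral_congr this, intervalIntegral.integral_add (kw.const_mul _)
      ((intervalIntegrable_of_integrableOn_Ioo i2 h0 ht).sub (kw.const_mul _)),
      intervalIntegral.integral_const_mul, intervalIntegral.integral_of_le ht.1,
      intervalIntegral.integral_of_le ht.1]
    congr 1
    refine setIntegral_congr_fun measurableSet_Ioc fun s hs => ?_
    rw [hu.2 s ⟨hs.1.le, hs.2.trans ht.2⟩, intervalIntegral.integral_of_le hs.1.le]
    ring
  beta_reduce
  rw [e1, e2, hu.2 t ht, hw.2 t ht, intervalIntegral.integral_of_le ht.1,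
    intervalIntegral.integral_of_le ht.1]
  linear_combination key

end IsPrim

/-! ### Weak derivatives and boundary values -/

section WeakDeriv

variable {l : ℝ} {f g w k : ℝ → ℂ}

theorem eq_zero_of_tsupport_subset {φ : ℝ → ℝ} (h : tsupport φ ⊆ Set.Ioo 0 l) {t : ℝ}
    (ht : t ∉ Set.Ioo 0 l) : φ t = 0 :=
  image_eq_zero_of_notMem_tsupport fun h' => ht (h h')

theorem integral_smul_eq_of_tsupport_subset {φ : ℝ → ℝ} (h : tsupport φ ⊆ Set.Ioo 0 l) :
    ∫ t in Set.Ioo 0 l, φ t • f t = ∫ t, φ t • f t :=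
  setIntegral_eq_integral_of_forall_compl_eq_zero fun t ht => by
    rw [eq_zero_of_tsupport_subset h ht, zero_smul]

theorem IsPrim.isWeakDeriv (hl : 0 ≤ l) (h : IsPrim l w k) : IsWeakDeriv l w k := by
  intro φ hφ _ hsupp
  have hd : IsPrim l (fun t => (φ t : ℂ)) (fun t => ((deriv φ t : ℝ) : ℂ)) := by
    refine isPrim_of_hasDerivAt (fun t _ => ?_) ?_
    · exact ((hφ.differentiable (by simp)) t).hasDerivAt.ofReal_comp
    · exact (Complex.continuous_ofReal.comp (hφ.continuous_deriv (by simp))).continuousOn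
  have hp := hd.mul h
  have h0 : φ 0 = 0 := eq_zero_of_tsupport_subset hsupp (by simp)
  have h1 : φ l = 0 := eq_zero_of_tsupport_subset hsupp (by simp)
  have e := hp.integral_eq hl
  rw [h0, h1] at e
  have i1 : IntegrableOn (fun t => ((deriv φ t : ℝ) : ℂ) * w t) (Set.Ioo 0 l) :=
    ((Complex.continuous_ofReal.comp (hφ.continuous_deriv (by simp))).continuousOn.mul
      (h.continuousOn hl)).integrableOn_Icc.mono_set Set.Ioo_subset_Icc_self
  have i2 : IntegrableOn (fun t => (φ t : ℂ) * k t) (Set.Ioo 0 l) :=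
    (hp.1.sub i1).congr (Eventually.of_forall fun t => by simp)
  rw [intervalIntegral.integral_of_le hl, integral_Ioc_eq_integral_Ioo, integral_add i1 i2] at e
  simp only [Complex.real_smul]
  rw [eq_neg_iff_add_eq_zero, e]
  simp

theorem IsWeakDeriv.congr (h : IsWeakDeriv l f g)
    (hf : ∀ᵐ t ∂(volume.restrict (Set.Ioo 0 l)), f t = w t)
    (hg : ∀ᵐ t ∂(volume.restrict (Set.Ioo 0 l)), g t = k t) : IsWeakDeriv l w k := by
  intro φ h1 h2 h3
  have e := h φ h1 h2 h3
  have e1 : ∫ t in Set.Ioo 0 l, deriv φ t • f t = ∫ t in Set.Ioo 0 l, deriv φ t • w t :=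
    integral_congr_ae (by filter_upwards [hf] with t ht; rw [ht])
  have e2 : ∫ t in Set.Ioo 0 l, φ t • g t = ∫ t in Set.Ioo 0 l, φ t • k t :=
    integral_congr_ae (by filter_upwards [hg] with t ht; rw [ht])
  rw [← e1, ← e2, e]

theorem integrableOn_smul_of_hasCompactSupport (hf : IntegrableOn f (Set.Ioo 0 l)) {φ : ℝ → ℝ}
    (hφ : Continuous φ) (hc : HasCompactSupport φ) :
    IntegrableOn (fun t => φ t • f t) (Set.Ioo 0 l) := by
  obtain ⟨K, hK⟩ := hφ.bounded_above_of_compact_support hc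
  exact hf.bdd_smul K hφ.aestronglyMeasurable (Eventually.of_forall hK)

/-- The primitive started at the left end of the support vanishes to the left of it trivially and to
the right of it because the mean is zero; so it is again a test function. -/
theorem exists_primitive_test_function {φ : ℝ → ℝ}
    (h1 : ContDiff ℝ ((⊤ : ℕ∞) : WithTop ℕ∞) φ) (h2 : HasCompactSupport φ)
    (h3 : tsupport φ ⊆ Set.Ioo 0 l) (h4 : ∫ t, φ t = 0) :
    ∃ θ : ℝ → ℝ, ContDiff ℝ ((⊤ : ℕ∞) : WithTop ℕ∞) θ ∧ HasCompactSupport θ ∧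
      tsupport θ ⊆ Set.Ioo 0 l ∧ deriv θ = φ := by
  rcases (tsupport φ).eq_empty_or_nonempty with he | hne
  · have hz : φ = 0 := by rwa [tsupport_eq_empty_iff] at he
    refine ⟨0, contDiff_const, HasCompactSupport.zero, ?_, ?_⟩
    · simp
    · rw [hz]; funext t; simp
  obtain ⟨a, ha, hamin⟩ := h2.isCompact.exists_isMinOn hne continuous_id.continuousOn
  obtain ⟨b, hb, hbmax⟩ := h2.isCompact.exists_isMaxOn hne continuous_id.continuousOn
  have hsub : tsupport φ ⊆ Set.Icc a b := fun t ht => ⟨hamin ht, hbmax ht⟩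
  have hz : ∀ t, t ∉ Set.Icc a b → φ t = 0 := fun t ht =>
    image_eq_zero_of_notMem_tsupport fun h => ht (hsub h)
  set θ : ℝ → ℝ := fun t => ∫ s in a..t, φ s with hθ
  have hd : ∀ t, HasDerivAt θ (φ t) t := fun t =>
    intervalIntegral.integral_hasDerivAt_right (h1.continuous.intervalIntegrable _ _)
      (h1.continuous.stronglyMeasurableAtFilter _ _) h1.continuous.continuousAt
  have hd' : deriv θ = φ := funext fun t => (hd t).deriv
  have hθz : ∀ t, t ∉ Set.Icc a b → θ t = 0 := by
    intro t ht
    rw [Set.mem_Icc, not_and_or, not_le, not_le] at ht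
    rcases ht with ht | ht
    · rw [hθ]
      refine (intervalIntegral.integral_congr_ae (g := fun _ => (0 : ℝ)) ?_).trans (by simp)
      have : ∀ᵐ s : ℝ, s ≠ a := by simp [ae_iff]
      filter_upwards [this] with s hs hs'
      rw [Set.uIoc_of_ge ht.le] at hs'
      exact hz s fun h => hs (le_antisymm hs'.2 h.1)
    · have hab : a ≤ t := (hsub ha).2.trans ht.le
      rw [hθ]
      simp only
      rw [intervalIntegral.integral_of_le hab, ← h4,
        ← integral_Icc_eq_integral_Ioc]
      exact setIntegral_eq_integral_of_forall_compl_eq_zero fun s hs =>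
        hz s fun h => hs ⟨h.1, h.2.trans ht.le⟩
  have hts : tsupport θ ⊆ Set.Icc a b :=
    closure_minimal (fun t ht => by_contra fun h => ht (hθz t h)) isClosed_Icc
  refine ⟨θ, ?_, isCompact_Icc.of_isClosed_subset (isClosed_tsupport θ) hts, ?_, hd'⟩
  · rw [contDiff_infty_iff_deriv]
    exact ⟨fun t => (hd t).differentiableAt, hd' ▸ h1⟩
  · exact hts.trans fun t ht => ⟨(h3 ha).1.trans_le ht.1, ht.2.trans_lt (h3 hb).2⟩

/-- A function with vanishing weak derivative is constant. -/
theorem IsWeakDeriv.ae_eq_const (hl : 0 < l) (hf : IntegrableOn f (Set.Ioo 0 l))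
    (h : IsWeakDeriv l f fun _ => 0) :
    ∃ c, ∀ᵐ t ∂(volume.restrict (Set.Ioo 0 l)), f t = c := by
  -- A bump around the midpoint with support of radius `l / 4`, hence inside `(0, l)`. Normalised,
  -- it serves to correct the mean of an arbitrary test function.
  let B : ContDiffBump (l / 2) := ⟨l / 8, l / 4, by positivity, by linarith⟩
  set ψ : ℝ → ℝ := B.normed volume with hψ
  have hψs : tsupport ψ ⊆ Set.Ioo 0 l := by
    rw [hψ, B.tsupport_normed_eq, Real.closedBall_eq_Icc]
    intro t ht
    have h1 := ht.1
    have h2 := ht.2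
    simp only [B] at h1 h2
    constructor <;> linarith
  have hψi : ∫ t, ψ t = 1 := B.integral_normed
  have hψc : HasCompactSupport ψ := B.hasCompactSupport_normed
  have hψd : ContDiff ℝ ((⊤ : ℕ∞) : WithTop ℕ∞) ψ := B.contDiff_normed
  have hint : ∀ φ : ℝ → ℝ, Continuous φ → HasCompactSupport φ →
      IntegrableOn (fun t => φ t • f t) (Set.Ioo 0 l) :=
    fun φ hφ hc => integrableOn_smul_of_hasCompactSupport hf hφ hc
  refine ⟨∫ t in Set.Ioo 0 l, ψ t • f t, ?_⟩
  set c := ∫ t in Set.Ioo 0 l, ψ t • f t with hc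
  have := isOpen_Ioo.ae_eq_zero_of_integral_contDiff_smul_eq_zero (μ := volume) (U := Set.Ioo 0 l)
    (f := fun t => f t - c) ?_ ?_
  · rw [ae_restrict_iff' measurableSet_Ioo]
    filter_upwards [this] with t ht h'
    exact sub_eq_zero.1 (ht h')
  · exact (hf.sub (integrableOn_const (by simp) (by simp))).locallyIntegrableOn
  · intro φ h1 h2 h3
    have hφc : Continuous φ := h1.continuous
    -- Testing the hypothesis with the primitive of `φ - (∫ φ) ψ` gives `∫ φ f = (∫ φ) c`, so `f -
    -- c` is orthogonal to all test functions.
    obtain ⟨θ, t1, t2, t3, t4⟩ := exists_primitive_test_function (l := l)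
      (φ := fun t => φ t - (∫ s, φ s) * ψ t) (h1.sub (contDiff_const.mul hψd))
      (h2.sub hψc.mul_left)
      ((tsupport_sub _ _).trans (Set.union_subset h3 ((tsupport_mul_subset_right).trans hψs)))
      (by
        rw [integral_sub (hφc.integrable_of_hasCompactSupport h2)
          ((hψd.continuous.integrable_of_hasCompactSupport hψc).const_mul _),
          integral_const_mul, hψi]
        ring)
    have e := h θ t1 t2 t3
    rw [t4] at e
    simp only [smul_zero, integral_zero, neg_zero, sub_smul, mul_smul] at e
    have hψf : IntegrableOn (fun t => (∫ s, φ s) • ψ t • f t) (Set.Ioo 0 l) :=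
      Integrable.fun_smul _ (hint ψ hψd.continuous hψc)
    rw [integral_sub (hint φ hφc h2) hψf, integral_smul, ← hc] at e
    rw [← integral_smul_eq_of_tsupport_subset h3]
    simp only [smul_sub]
    rw [integral_sub (hint φ hφc h2)
      ((hφc.integrable_of_hasCompactSupport h2).integrableOn.smul_const c),
      integral_smul_const]
    have : ∫ t in Set.Ioo 0 l, φ t = ∫ t, φ t :=
      setIntegral_eq_integral_of_forall_compl_eq_zero fun t ht => eq_zero_of_tsupport_subset h3 ht
    rw [this, e]

/-- The difference of `f` and the primitive of `k` has weak derivative zero, so it is almost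
everywhere constant. -/
theorem IsWeakDeriv.exists_isPrim (hl : 0 < l) (hf : IntegrableOn f (Set.Ioo 0 l))
    (hk : IntegrableOn k (Set.Ioo 0 l)) (h : IsWeakDeriv l f k) :
    ∃ w, IsPrim l w k ∧ ∀ᵐ t ∂(volume.restrict (Set.Ioo 0 l)), f t = w t := by
  have hW := isPrim_primitive hk 0
  have hWi : IntegrableOn (fun t => (0 : ℂ) + ∫ s in (0 : ℝ)..t, k s) (Set.Ioo 0 l) :=
    (hW.continuousOn hl.le).integrableOn_Icc.mono_set Set.Ioo_subset_Icc_self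
  have hd : IsWeakDeriv l (fun t => f t - (0 + ∫ s in (0 : ℝ)..t, k s)) fun _ => 0 := by
    intro φ h1 h2 h3
    have e1 := h φ h1 h2 h3
    have e2 := hW.isWeakDeriv hl.le φ h1 h2 h3
    have hdc : Continuous (deriv φ) := h1.continuous_deriv (by simp)
    simp only [smul_sub, smul_zero, integral_zero, neg_zero]
    rw [integral_sub (integrableOn_smul_of_hasCompactSupport hf hdc h2.deriv)
      (integrableOn_smul_of_hasCompactSupport hWi hdc h2.deriv), e1, e2, sub_self]
  obtain ⟨c, hc⟩ := hd.ae_eq_const hl (hf.sub hWi)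
  refine ⟨fun t => c + ∫ s in (0 : ℝ)..t, k s, isPrim_primitive hk c, ?_⟩
  filter_upwards [hc] with t ht
  have ht' : f t - (0 + ∫ s in (0 : ℝ)..t, k s) = c := ht
  rw [← ht']; ring

/-- Every neighbourhood of a point of `[0, l]` meets `(0, l)` in a nonempty open set, which has
positive measure. This makes boundary values unique. -/
theorem neBot_nhdsWithin_inf_ae (hl : 0 < l) {a : ℝ} (ha : a ∈ Set.Icc 0 l) :
    (𝓝[Set.Ioo 0 l] a ⊓ ae volume).NeBot := by
  rw [Filter.inf_neBot_iff]
  intro s hs s' hs'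
  obtain ⟨U, hU, haU, hUs⟩ := mem_nhdsWithin.1 hs
  have hne : (U ∩ Set.Ioo 0 l).Nonempty := by
    have : a ∈ closure (Set.Ioo 0 l) := by rwa [closure_Ioo hl.ne]
    exact mem_closure_iff.1 this U hU haU
  have hpos := (hU.inter isOpen_Ioo).measure_pos volume hne
  by_contra hcon
  have hsub : U ∩ Set.Ioo 0 l ⊆ s'ᶜ := fun t ht ht' => hcon ⟨t, hUs ht, ht'⟩
  exact hpos.ne' (measure_mono_null hsub hs')

theorem hasBoundaryValue_iff (hl : 0 < l)
    (hf : ∀ᵐ t ∂(volume.restrict (Set.Ioo 0 l)), f t = w t)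
    (hw : ContinuousOn w (Set.Icc 0 l)) {a : ℝ} (ha : a ∈ Set.Icc 0 l) (c : ℂ) :
    HasBoundaryValue l f a c ↔ w a = c := by
  have hev : f =ᶠ[𝓝[Set.Ioo 0 l] a ⊓ ae volume] w := by
    rw [ae_restrict_iff' measurableSet_Ioo] at hf
    have h1 : ∀ᶠ t in 𝓝[Set.Ioo 0 l] a ⊓ ae volume, t ∈ Set.Ioo 0 l :=
      (eventually_mem_nhdsWithin).filter_mono inf_le_left
    filter_upwards [h1, hf.filter_mono inf_le_right] with t h1 h2 using h2 h1
  have hlim : Tendsto f (𝓝[Set.Ioo 0 l] a ⊓ ae volume) (𝓝 (w a)) :=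
    (Tendsto.mono_left ((hw a ha).mono Set.Ioo_subset_Icc_self) inf_le_left).congr' hev.symm
  have := neBot_nhdsWithin_inf_ae hl ha
  exact ⟨fun h => tendsto_nhds_unique hlim h, fun h => h ▸ hlim⟩

end WeakDeriv

/-! ### Estimates on a single edge -/

section Edge

variable {l : ℝ} {w k F F₁ : ℝ → ℂ}

theorem integrable_normSq_of_continuousOn (h : ContinuousOn w (Set.Icc 0 l)) :
    IntegrableOn (fun t => ‖w t‖ ^ 2) (Set.Ioo 0 l) :=
  ((h.norm.pow 2).integrableOn_Icc).mono_set Set.Ioo_subset_Icc_self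

theorem memLp_of_continuousOn (h : ContinuousOn w (Set.Icc 0 l)) :
    MemLp w 2 (volume.restrict (Set.Ioo 0 l)) :=
  (memLp_two_iff_integrable_sq_norm
    ((h.mono Set.Ioo_subset_Icc_self).aestronglyMeasurable measurableSet_Ioo)).2
    (integrable_normSq_of_continuousOn h)

theorem IsPrim.integral_Ioo_eq (h : IsPrim l w k) (hl : 0 ≤ l) :
    ∫ s in Set.Ioo 0 l, k s = w l - w 0 := by
  rw [← h.integral_eq hl, intervalIntegral.integral_of_le hl, integral_Ioc_eq_integral_Ioo]

/-- Integrate the derivative of `m |w|²`. The slope of the weight `m` gives the term with `1 / l`,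
and Young's inequality splits the mixed term `2 |w| |k|` with parameter `δ`. An affine `m` that is
`1` at one end and `0` at the other isolates a single boundary value. -/
theorem IsPrim.normSq_end_le_aux (hl : 0 < l) (h : IsPrim l w k)
    (hk : MemLp k 2 (volume.restrict (Set.Ioo 0 l))) {δ : ℝ} (hδ : 0 < δ) {m : ℝ → ℝ} {m' : ℝ}
    (hm : ∀ t, HasDerivAt m m' t) (hm1 : ∀ t ∈ Set.Ioo 0 l, |m t| ≤ 1) (hm' : |m'| ≤ 1 / l) :
    ‖(m l : ℂ) * (w l * starRingEnd ℂ (w l)) - m 0 * (w 0 * starRingEnd ℂ (w 0))‖ ≤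
      δ * (∫ t in Set.Ioo 0 l, ‖k t‖ ^ 2) +
        (1 / l + 1 / δ) * ∫ t in Set.Ioo 0 l, ‖w t‖ ^ 2 := by
  have hmP : IsPrim l (fun t => (m t : ℂ)) (fun _ => (m' : ℂ)) :=
    isPrim_of_hasDerivAt (fun t _ => (hm t).ofReal_comp) continuousOn_const
  have hp := hmP.mul (h.mul h.conj)
  rw [← hp.integral_Ioo_eq hl.le]
  have hc := h.continuousOn hl.le
  have i1 := (integrable_normSq_of_continuousOn hc).const_mul (1 / l + 1 / δ)
  have i2 := ((memLp_two_iff_integrable_sq_norm hk.1).1 hk).const_mul δ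
  rw [← integral_const_mul, ← integral_const_mul, ← integral_add i2 i1]
  refine norm_integral_le_of_norm_le (i2.add i1) ?_
  filter_upwards [ae_restrict_mem measurableSet_Ioo] with t ht
  set a := ‖w t‖ with ha
  set b := ‖k t‖ with hb
  have e1 : ‖(m' : ℂ) * (w t * starRingEnd ℂ (w t))‖ ≤ 1 / l * a ^ 2 := by
    rw [norm_mul, norm_mul, RCLike.norm_conj, Complex.norm_real, Real.norm_eq_abs, ← pow_two]
    gcongr
  have e2 : ‖(m t : ℂ) * (k t * starRingEnd ℂ (w t) + w t * starRingEnd ℂ (k t))‖ ≤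
      2 * (a * b) := by
    rw [norm_mul, Complex.norm_real, Real.norm_eq_abs]
    calc _ ≤ 1 * (‖k t * starRingEnd ℂ (w t)‖ + ‖w t * starRingEnd ℂ (k t)‖) := by
          gcongr
          · exact hm1 t ht
          · exact norm_add_le _ _
      _ = 2 * (a * b) := by rw [norm_mul, norm_mul, RCLike.norm_conj, RCLike.norm_conj]; ring
  have e3 : 2 * (a * b) ≤ δ * b ^ 2 + 1 / δ * a ^ 2 := by
    have : 0 ≤ δ * (b - a / δ) ^ 2 := by positivity
    have e : δ * (b - a / δ) ^ 2 = δ * b ^ 2 + 1 / δ * a ^ 2 - 2 * (a * b) := by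
      field_simp
      ring
    linarith
  refine (norm_add_le _ _).trans ?_
  linarith

/-- Sobolev's trace inequality on an interval. -/
theorem IsPrim.normSq_end_le (hl : 0 < l) (h : IsPrim l w k)
    (hk : MemLp k 2 (volume.restrict (Set.Ioo 0 l))) {δ : ℝ} (hδ : 0 < δ) (b : Bool) :
    ‖w (if b then l else 0)‖ ^ 2 ≤ δ * (∫ t in Set.Ioo 0 l, ‖k t‖ ^ 2) +
      (1 / l + 1 / δ) * ∫ t in Set.Ioo 0 l, ‖w t‖ ^ 2 := by
  cases b
  · have := h.normSq_end_le_aux hl hk hδ (m := fun t => 1 - t / l) (m' := -(1 / l))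
      (fun t => by simpa using ((hasDerivAt_id t).div_const l).const_sub 1)
      (fun t ht => by
        have h1 : 0 < t / l := div_pos ht.1 hl
        have h2 : t / l < 1 := (div_lt_one hl).2 ht.2
        rw [abs_le]; constructor <;> linarith)
      (by rw [abs_neg, abs_of_pos (by positivity)])
    simpa [hl.ne', ← pow_two] using this
  · have := h.normSq_end_le_aux hl hk hδ (m := fun t => t / l) (m' := 1 / l)
      (fun t => by simpa using ((hasDerivAt_id t).div_const l))
      (fun t ht => by
        have h1 : 0 < t / l := div_pos ht.1 hl
        have h2 : t / l < 1 := (div_lt_one hl).2 ht.2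
        rw [abs_le]; constructor <;> linarith)
      (by rw [abs_of_pos (by positivity)])
    simpa [hl.ne', ← pow_two] using this

theorem re_conj_mul_self (z : ℂ) : (starRingEnd ℂ z * z).re = ‖z‖ ^ 2 := by
  rw [mul_comm, Complex.mul_conj, Complex.ofReal_re, Complex.normSq_eq_norm_sq]

/-- Green's formula on an interval. -/
theorem IsPrim.integral_conj_mul_neg (hl : 0 ≤ l) (h : IsPrim l F F₁) (h₁ : IsPrim l F₁ k) :
    IntegrableOn (fun t => starRingEnd ℂ (F t) * -k t) (Set.Ioo 0 l) ∧
    (∫ t in Set.Ioo 0 l, starRingEnd ℂ (F t) * -k t).re =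
      (∫ t in Set.Ioo 0 l, ‖F₁ t‖ ^ 2) + (starRingEnd ℂ (F 0) * F₁ 0).re +
        -(starRingEnd ℂ (F l) * F₁ l).re := by
  have hp := h.conj.mul h₁
  have hc₁ := h₁.continuousOn hl
  have i1 : IntegrableOn (fun t => starRingEnd ℂ (F₁ t) * F₁ t) (Set.Ioo 0 l) :=
    ((Complex.continuous_conj.comp_continuousOn hc₁).mul hc₁).integrableOn_Icc.mono_set
      Set.Ioo_subset_Icc_self
  have i2 : IntegrableOn (fun t => starRingEnd ℂ (F t) * -k t) (Set.Ioo 0 l) :=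
    (i1.sub hp.1).congr (Eventually.of_forall fun t => by simp)
  refine ⟨i2, ?_⟩
  have e := hp.integral_Ioo_eq hl
  have e2 : ∫ t in Set.Ioo 0 l, starRingEnd ℂ (F t) * -k t =
      (∫ t in Set.Ioo 0 l, starRingEnd ℂ (F₁ t) * F₁ t) -
        (starRingEnd ℂ (F l) * F₁ l - starRingEnd ℂ (F 0) * F₁ 0) := by
    rw [← e, ← integral_sub i1 hp.1]
    exact integral_congr_ae (Eventually.of_forall fun t => by simp)
  have e3 : (∫ t in Set.Ioo 0 l, starRingEnd ℂ (F₁ t) * F₁ t).re =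
      ∫ t in Set.Ioo 0 l, ‖F₁ t‖ ^ 2 := by
    have := integral_re i1
    simp only [RCLike.re_eq_complex_re, re_conj_mul_self] at this
    exact this.symm
  rw [e2, Complex.sub_re, Complex.sub_re, e3]
  ring

/-- `F` and `F₁` are the absolutely continuous representatives of `f` and `f₁ = f'`, where
`f'' = f₂`. -/
structure IsEdgeRep (l : ℝ) (f f₁ f₂ F F₁ : ℝ → ℂ) : Prop where
  prim : IsPrim l F F₁
  prim₁ : IsPrim l F₁ f₂
  eq : ∀ᵐ t ∂(volume.restrict (Set.Ioo 0 l)), f t = F t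
  eq₁ : ∀ᵐ t ∂(volume.restrict (Set.Ioo 0 l)), f₁ t = F₁ t

theorem integrableOn_of_Lp (f : Lp ℂ 2 (volume.restrict (Set.Ioo 0 l))) :
    IntegrableOn (f : ℝ → ℂ) (Set.Ioo 0 l) :=
  (Lp.memLp f).integrable (by norm_num)

theorem exists_isEdgeRep_iff (hl : 0 < l) (f f₁ f₂ : Lp ℂ 2 (volume.restrict (Set.Ioo 0 l))) :
    (IsWeakDeriv l f f₁ ∧ IsWeakDeriv l f₁ f₂) ↔ ∃ F F₁, IsEdgeRep l f f₁ f₂ F F₁ := by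
  constructor
  · rintro ⟨h, h₁⟩
    obtain ⟨F, hF, hFe⟩ := h.exists_isPrim hl (integrableOn_of_Lp f) (integrableOn_of_Lp f₁)
    obtain ⟨F₁, hF₁, hFe₁⟩ := h₁.exists_isPrim hl (integrableOn_of_Lp f₁) (integrableOn_of_Lp f₂)
    exact ⟨F, F₁, hF.congr_deriv hFe₁, hF₁, hFe, hFe₁⟩
  · rintro ⟨F, F₁, h⟩
    constructor
    · exact (h.prim.isWeakDeriv hl.le).congr (h.eq.mono fun _ h => h.symm)
        (h.eq₁.mono fun _ h => h.symm)
    · exact (h.prim₁.isWeakDeriv hl.le).congr (h.eq₁.mono fun _ h => h.symm)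
        (Eventually.of_forall fun _ => rfl)

theorem normSq_eq_of_ae_eq {f : Lp ℂ 2 (volume.restrict (Set.Ioo 0 l))}
    (h : ∀ᵐ t ∂(volume.restrict (Set.Ioo 0 l)), f t = F t) :
    ‖f‖ ^ 2 = ∫ t in Set.Ioo 0 l, ‖F t‖ ^ 2 := by
  have h1 : ((‖f‖ ^ 2 : ℝ) : ℂ) = ⟪f, f⟫_ℂ := by
    rw [inner_self_eq_norm_sq_to_K]; push_cast; rfl
  rw [L2.inner_def] at h1
  have h2 : ∫ t in Set.Ioo 0 l, ⟪f t, f t⟫_ℂ = ∫ t in Set.Ioo 0 l, ((‖F t‖ ^ 2 : ℝ) : ℂ) := by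
    refine integral_congr_ae ?_
    filter_upwards [h] with t ht
    rw [ht, inner_self_eq_norm_sq_to_K]; push_cast; rfl
  rw [h2, integral_complex_ofReal] at h1
  exact_mod_cast h1

/-- The quadratic form of `-f'' + Wf` on an edge. -/
theorem IsEdgeRep.re_inner_eq (hl : 0 < l)
    {f f₁ f₂ g : Lp ℂ 2 (volume.restrict (Set.Ioo 0 l))} (h : IsEdgeRep l f f₁ f₂ F F₁)
    {W : ℝ → ℝ} (hW : AEStronglyMeasurable W (volume.restrict (Set.Ioo 0 l))) {Q : ℝ}
    (hQ : ∀ᵐ t ∂(volume.restrict (Set.Ioo 0 l)), |W t| ≤ Q)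
    (hg : ∀ᵐ t ∂(volume.restrict (Set.Ioo 0 l)), g t = -f₂ t + (W t : ℂ) * f t) :
    IntegrableOn (fun t => W t * ‖F t‖ ^ 2) (Set.Ioo 0 l) ∧
    (⟪f, g⟫_ℂ).re = (∫ t in Set.Ioo 0 l, ‖F₁ t‖ ^ 2) + (starRingEnd ℂ (F 0) * F₁ 0).re +
        -(starRingEnd ℂ (F l) * F₁ l).re + ∫ t in Set.Ioo 0 l, W t * ‖F t‖ ^ 2 := by
  obtain ⟨i1, e1⟩ := h.prim.integral_conj_mul_neg hl.le h.prim₁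
  have hc := h.prim.continuousOn hl.le
  have i2 : IntegrableOn (fun t => W t * ‖F t‖ ^ 2) (Set.Ioo 0 l) :=
    (integrable_normSq_of_continuousOn hc).bdd_mul hW hQ
  refine ⟨i2, ?_⟩
  rw [← e1, L2.inner_def]
  have e2 : ∫ t in Set.Ioo 0 l, ⟪f t, g t⟫_ℂ = ∫ t in Set.Ioo 0 l,
      (starRingEnd ℂ (F t) * -f₂ t + ((W t * ‖F t‖ ^ 2 : ℝ) : ℂ)) := by
    refine integral_congr_ae ?_
    filter_upwards [h.eq, hg] with t h1 h2
    rw [h2, h1, RCLike.inner_apply]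
    have : ((‖F t‖ ^ 2 : ℝ) : ℂ) = F t * starRingEnd ℂ (F t) := by
      rw [Complex.mul_conj, Complex.normSq_eq_norm_sq]
    rw [Complex.ofReal_mul, this]
    ring
  have i3 : IntegrableOn (fun t => ((W t * ‖F t‖ ^ 2 : ℝ) : ℂ)) (Set.Ioo 0 l) := i2.ofReal
  rw [e2, integral_add i1 i3, Complex.add_re, integral_complex_ofReal, Complex.ofReal_re]

/-- Lower bound for the quadratic form on an edge in terms of the boundary values. -/
theorem IsEdgeRep.boundary_le (hl : 0 < l) {u S Q : ℝ} (hu : 0 < u) (hul : u ≤ l) (hS : 0 < S)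
    {f f₁ f₂ g : Lp ℂ 2 (volume.restrict (Set.Ioo 0 l))} (h : IsEdgeRep l f f₁ f₂ F F₁)
    {W : ℝ → ℝ} (hW : AEStronglyMeasurable W (volume.restrict (Set.Ioo 0 l)))
    (hQ : ∀ᵐ t ∂(volume.restrict (Set.Ioo 0 l)), |W t| ≤ Q)
    (hg : ∀ᵐ t ∂(volume.restrict (Set.Ioo 0 l)), g t = -f₂ t + (W t : ℂ) * f t) :
    ((starRingEnd ℂ (F 0) * F₁ 0).re + S * ‖F 0‖ ^ 2) +
      (-(starRingEnd ℂ (F l) * F₁ l).re + S * ‖F l‖ ^ 2) ≤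
      (⟪f, g⟫_ℂ).re + (Q + 2 * S * (1 / u + 2 * S)) * ‖f‖ ^ 2 := by
  obtain ⟨i, e⟩ := h.re_inner_eq hl hW hQ hg
  have hc := h.prim.continuousOn hl.le
  have hc₁ := h.prim₁.continuousOn hl.le
  have hV : -(Q * ∫ t in Set.Ioo 0 l, ‖F t‖ ^ 2) ≤ ∫ t in Set.Ioo 0 l, W t * ‖F t‖ ^ 2 := by
    rw [← integral_const_mul, ← integral_neg]
    refine integral_mono_ae ((integrable_normSq_of_continuousOn hc).const_mul Q).neg i ?_
    filter_upwards [hQ] with t ht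
    have := (abs_le.1 ht).1
    have h2 : 0 ≤ ‖F t‖ ^ 2 := by positivity
    nlinarith
  -- With this `δ`, the term `S |F|²` at each end costs at most half of `∫ |F'|²`, so the two ends
  -- together are absorbed by the kinetic energy.
  have hδ : (0 : ℝ) < 1 / (2 * S) := by positivity
  have t0 := h.prim.normSq_end_le hl (memLp_of_continuousOn hc₁) hδ false
  have t1 := h.prim.normSq_end_le hl (memLp_of_continuousOn hc₁) hδ true
  simp only [Bool.false_eq_true, if_false, if_true] at t0 t1
  rw [e, normSq_eq_of_ae_eq h.eq]
  set a := ∫ t in Set.Ioo 0 l, ‖F₁ t‖ ^ 2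
  set b := ∫ t in Set.Ioo 0 l, ‖F t‖ ^ 2
  have hb : 0 ≤ b := integral_nonneg fun t => by positivity
  have hlu : 1 / l ≤ 1 / u := one_div_le_one_div_of_le hu hul
  have e1 : 1 / (1 / (2 * S)) = 2 * S := by field_simp
  rw [e1] at t0 t1
  have s0 := mul_le_mul_of_nonneg_left t0 hS.le
  have s1 := mul_le_mul_of_nonneg_left t1 hS.le
  have e2 : S * (1 / (2 * S) * a + (1 / l + 2 * S) * b) =
      a / 2 + S * (1 / l + 2 * S) * b := by field_simp
  rw [e2] at s0 s1
  have e3 : S * (1 / l + 2 * S) * b ≤ S * (1 / u + 2 * S) * b := by gcongr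
  linarith

/-- The boundary values of `f` and `f'` on an edge are controlled by `f`, `f'` and `f''`. -/
theorem IsEdgeRep.normSq_end_add_le (hl : 0 < l) {u : ℝ} (hu : 0 < u) (hul : u ≤ l)
    {f f₁ f₂ : Lp ℂ 2 (volume.restrict (Set.Ioo 0 l))} (h : IsEdgeRep l f f₁ f₂ F F₁) (b : Bool) :
    ‖F (if b then l else 0)‖ ^ 2 + ‖F₁ (if b then l else 0)‖ ^ 2 ≤
      (1 / u + 2) * (‖f‖ ^ 2 + ‖f₁‖ ^ 2 + ‖f₂‖ ^ 2) := by
  have hc₁ := h.prim₁.continuousOn hl.le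
  have t0 := h.prim.normSq_end_le hl (memLp_of_continuousOn hc₁) one_pos b
  have t1 := h.prim₁.normSq_end_le hl (Lp.memLp f₂) one_pos b
  rw [← normSq_eq_of_ae_eq h.eq₁] at t0 t1
  rw [← normSq_eq_of_ae_eq h.eq] at t0
  rw [← normSq_eq_of_ae_eq (f := f₂) (Eventually.of_forall fun _ => rfl)] at t1
  have hlu : 1 / l ≤ 1 / u := one_div_le_one_div_of_le hu hul
  have p : 0 < 1 / u := by positivity
  nlinarith [sq_nonneg ‖f‖, sq_nonneg ‖f₁‖, sq_nonneg ‖f₂‖]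

end Edge

/-! ### Green's formula on the graph -/

section Graph

variable {E V : Type*} {G : MetricGraph E V} {bc : BoundaryCondition G} {A : Set E}

/-- `F` and `F₁` are edgewise absolutely continuous representatives of `f` and `f' = f₁`. -/
def IsRep (G : MetricGraph E V) {A : Set E} (f f₁ f₂ : G.L2 A) (F F₁ : A → ℝ → ℂ) : Prop :=
  ∀ e : A, IsEdgeRep (G.len e) (f e) (f₁ e) (f₂ e) (F e) (F₁ e)

/-- The boundary conditions of `operatorGraph`, in terms of continuous representatives `F`
and `F₁` of a function and its derivative. -/
def SatisfiesBC (bc : BoundaryCondition G) (A : Set E) (F F₁ : A → ℝ → ℂ) : Prop :=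
  (∀ v, G.IsInner A v → ∃ x y : G.VertexSpace v,
    (∀ p : G.Ends v, ∀ hp : p.1.1 ∈ A, F ⟨p.1.1, hp⟩ (G.endCoord p.1) = x p) ∧
    (∀ p : G.Ends v, ∀ hp : p.1.1 ∈ A, F₁ ⟨p.1.1, hp⟩ (G.endCoord p.1) = endSign p.1 * y p) ∧
    bc.Holds v x y) ∧
  ∀ v, G.IsBoundary A v → ∀ p : G.Ends v, ∀ hp : p.1.1 ∈ A,
    F ⟨p.1.1, hp⟩ (G.endCoord p.1) = 0

theorem endCoord_mem_Icc (p : E × Bool) : G.endCoord p ∈ Set.Icc 0 (G.len p.1) := by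
  have := (G.len_pos p.1).le
  unfold MetricGraph.endCoord
  split_ifs <;> simp [this]

theorem IsEdgeRep.hasBoundaryValue_iff {p : E × Bool} {f f₁ f₂ F F₁ : ℝ → ℂ}
    (h : IsEdgeRep (G.len p.1) f f₁ f₂ F F₁) (c : ℂ) :
    HasBoundaryValue (G.len p.1) f (G.endCoord p) c ↔ F (G.endCoord p) = c :=
  QGraph.hasBoundaryValue_iff (G.len_pos _) h.eq (h.prim.continuousOn (G.len_pos _).le)
    (endCoord_mem_Icc p) c

theorem IsEdgeRep.hasBoundaryValue_deriv_iff {p : E × Bool} {f f₁ f₂ F F₁ : ℝ → ℂ}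
    (h : IsEdgeRep (G.len p.1) f f₁ f₂ F F₁) (c : ℂ) :
    HasBoundaryValue (G.len p.1) f₁ (G.endCoord p) c ↔ F₁ (G.endCoord p) = c :=
  QGraph.hasBoundaryValue_iff (G.len_pos _) h.eq₁ (h.prim₁.continuousOn (G.len_pos _).le)
    (endCoord_mem_Icc p) c

theorem IsRep.isTrace_iff {f f₁ f₂ : G.L2 A} {F F₁ : A → ℝ → ℂ} (h : IsRep G f f₁ f₂ F F₁)
    (v : V) (x : G.VertexSpace v) : IsTrace G f v x ↔
      ∀ p : G.Ends v, ∀ hp : p.1.1 ∈ A, F ⟨p.1.1, hp⟩ (G.endCoord p.1) = x p :=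
  forall_congr' fun _ => forall_congr' fun hp => (h ⟨_, hp⟩).hasBoundaryValue_iff _

theorem IsRep.isSignedTrace_iff {f f₁ f₂ : G.L2 A} {F F₁ : A → ℝ → ℂ}
    (h : IsRep G f f₁ f₂ F F₁) (v : V) (y : G.VertexSpace v) : IsSignedTrace G f₁ v y ↔
      ∀ p : G.Ends v, ∀ hp : p.1.1 ∈ A,
        F₁ ⟨p.1.1, hp⟩ (G.endCoord p.1) = endSign p.1 * y p :=
  forall_congr' fun _ => forall_congr' fun hp => (h ⟨_, hp⟩).hasBoundaryValue_deriv_iff _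

theorem isSobolev2_iff {f f₁ f₂ : G.L2 A} :
    IsSobolev2 G f f₁ f₂ ↔ ∃ F F₁, IsRep G f f₁ f₂ F F₁ := by
  unfold IsSobolev2 IsRep
  simp only [fun e : A => exists_isEdgeRep_iff (G.len_pos e) (f e) (f₁ e) (f₂ e)]
  constructor
  · intro h
    choose F F₁ h using h
    exact ⟨F, F₁, h⟩
  · rintro ⟨F, F₁, h⟩ e
    exact ⟨F e, F₁ e, h e⟩

/-- Passes from weak derivatives and limits along filters to absolutely continuous representatives
evaluated at the ends; the later arguments about the domain use this form. -/
theorem mem_operatorGraph_iff {ν : E → ℝ → ℝ} {q : E → ℝ} {fg : G.L2 A × G.L2 A} :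
    fg ∈ operatorGraph G bc ν q A ↔ ∃ (f₁ f₂ : G.L2 A) (F F₁ : A → ℝ → ℂ),
      IsRep G fg.1 f₁ f₂ F F₁ ∧ SatisfiesBC bc A F F₁ ∧
      ∀ e : A, ∀ᵐ t ∂(G.edgeMeasure e),
        (fg.2 e : ℝ → ℂ) t = -(f₂ e : ℝ → ℂ) t + ((q e * ν e t : ℝ) : ℂ) * (fg.1 e : ℝ → ℂ) t := by
  unfold operatorGraph
  constructor
  · rintro ⟨f₁, f₂, hs, hin, hbd, hg⟩
    obtain ⟨F, F₁, hr⟩ := isSobolev2_iff.1 hs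
    refine ⟨f₁, f₂, F, F₁, hr, ⟨fun v hv => ?_, fun v hv p hp => ?_⟩, hg⟩
    · obtain ⟨x, y, hx, hy, hb⟩ := hin v hv
      exact ⟨x, y, (hr.isTrace_iff v x).1 hx, (hr.isSignedTrace_iff v y).1 hy, hb⟩
    · simpa using (hr.isTrace_iff v 0).1 (hbd v hv) p hp
  · rintro ⟨f₁, f₂, F, F₁, hr, ⟨hin, hbd⟩, hg⟩
    refine ⟨f₁, f₂, isSobolev2_iff.2 ⟨F, F₁, hr⟩, fun v hv => ?_, fun v hv => ?_, hg⟩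
    · obtain ⟨x, y, hx, hy, hb⟩ := hin v hv
      exact ⟨x, y, (hr.isTrace_iff v x).2 hx, (hr.isSignedTrace_iff v y).2 hy, hb⟩
    · exact (hr.isTrace_iff v 0).2 fun p hp => by simpa using hbd v hv p hp

/-- Since `x` lies in the kernel of the self-adjoint `P v`, pairing it with `y` only sees `(1 - P v)
y = L v x`, and `L v ≥ -S` applies. -/
theorem BoundaryCondition.Holds.re_inner_ge {v : V} {x y : G.VertexSpace v}
    (h : bc.Holds v x y) : 0 ≤ (⟪x, y + (bc.S : ℂ) • x⟫_ℂ).re := by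
  obtain ⟨z, hz, hL⟩ := h
  have hx : bc.P v x = 0 := by rw [← hz]; exact (z : (bc.P v).ker).2
  have hb := bc.lower_bound v z
  have hPy : ⟪x, bc.P v y⟫_ℂ = 0 := by
    have hsa := (bc.isStarProjection v).isSelfAdjoint
    rw [← ContinuousLinearMap.adjoint_inner_left, ← ContinuousLinearMap.star_eq_adjoint,
      hsa.star_eq, hx, inner_zero_left]
  have e1 : ⟪x, y⟫_ℂ = ⟪x, y - bc.P v y⟫_ℂ := by rw [inner_sub_right, hPy, sub_zero]
  have e2 : ⟪bc.L v z, (z : (bc.P v).ker)⟫_ℂ = ⟪y - bc.P v y, x⟫_ℂ := by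
    rw [← hL, ← hz]; rfl
  have e3 : ‖(z : (bc.P v).ker)‖ = ‖x‖ := by rw [← hz]; rfl
  rw [e2, e3, ← inner_conj_symm, ← e1, Complex.conj_re] at hb
  have e4 : (⟪x, x⟫_ℂ).re = ‖x‖ ^ 2 := by
    rw [inner_self_eq_norm_sq_to_K]; norm_cast
  rw [inner_add_right, inner_smul_right, Complex.add_re, Complex.re_ofReal_mul, e4]
  linarith

/-- The contribution of an edge end to Green's formula, shifted by the bound of the `L_v`. -/
def boundaryTerm (G : MetricGraph E V) {A : Set E} (S : ℝ) (F F₁ : A → ℝ → ℂ) (p : A × Bool) :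
    ℝ :=
  (starRingEnd ℂ (F p.1 (G.endCoord (p.1, p.2))) *
      (endSign ((p.1 : E), p.2) * F₁ p.1 (G.endCoord (p.1, p.2)))).re +
    S * ‖F p.1 (G.endCoord (p.1, p.2))‖ ^ 2

theorem summable_norm_sq_lp {ι : Type*} {B : ι → Type*} [∀ i, NormedAddCommGroup (B i)]
    (f : lp B 2) : Summable fun i => ‖f i‖ ^ 2 := by
  have := (lp.memℓp f).summable (by norm_num)
  simpa using this

theorem endSign_mul_self (p : E × Bool) : endSign p * endSign p = 1 := by
  unfold endSign; split_ifs <;> norm_num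

theorem norm_endSign (p : E × Bool) : ‖endSign p‖ = 1 := by
  unfold endSign; split_ifs <;> norm_num

/-- Absolute convergence is what permits regrouping the boundary terms from edges to vertices on an
infinite graph. The lower bound `u` on the lengths makes the trace inequality uniform in the edge.
-/
theorem IsRep.summable_boundaryTerm {u U : ℝ} (hG : G.LengthBounds u U) {f f₁ f₂ : G.L2 A}
    {F F₁ : A → ℝ → ℂ} (h : IsRep G f f₁ f₂ F F₁) {S : ℝ} (hS : 0 < S) :
    Summable (boundaryTerm G S F F₁) := by
  have hs : Summable fun e : A => ‖f e‖ ^ 2 + ‖f₁ e‖ ^ 2 + ‖f₂ e‖ ^ 2 :=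
    ((summable_norm_sq_lp f).add (summable_norm_sq_lp f₁)).add (summable_norm_sq_lp f₂)
  -- The factor `1` is a function on `Bool`: it turns the bound into a product of a summable family
  -- over edges and a finite one over ends.
  have hp : Summable fun p : A × Bool =>
      ((1 + S) * (1 / u + 2) * (‖f p.1‖ ^ 2 + ‖f₁ p.1‖ ^ 2 + ‖f₂ p.1‖ ^ 2)) * (1 : ℝ) :=
    (hs.mul_left ((1 + S) * (1 / u + 2))).mul_of_nonneg (g := fun _ : Bool => (1 : ℝ))
      (Summable.of_finite) (fun e => by have := hG.1; positivity) (fun _ => zero_le_one)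
  refine Summable.of_norm_bounded hp fun p => ?_
  have hb := (h p.1).normSq_end_add_le (G.len_pos _) hG.1 (hG.2.2 _).1 p.2
  have hc : (if p.2 = true then G.len p.1 else 0) = G.endCoord ((p.1 : E), p.2) := rfl
  rw [hc] at hb
  unfold boundaryTerm
  set X := F p.1 (G.endCoord ((p.1 : E), p.2))
  set Y := F₁ p.1 (G.endCoord ((p.1 : E), p.2))
  rw [Real.norm_eq_abs]
  have h1 : |(starRingEnd ℂ X * (endSign ((p.1 : E), p.2) * Y)).re| ≤ ‖X‖ * ‖Y‖ := by
    refine (Complex.abs_re_le_norm _).trans ?_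
    rw [norm_mul, norm_mul, RCLike.norm_conj, norm_endSign, one_mul]
  have h2 : ‖X‖ * ‖Y‖ ≤ ‖X‖ ^ 2 + ‖Y‖ ^ 2 := by
    nlinarith [sq_nonneg (‖X‖ - ‖Y‖), sq_nonneg (‖X‖ + ‖Y‖)]
  calc _ ≤ |(starRingEnd ℂ X * (endSign ((p.1 : E), p.2) * Y)).re| + |S * ‖X‖ ^ 2| := abs_add_le _ _
    _ ≤ (‖X‖ ^ 2 + ‖Y‖ ^ 2) + S * (‖X‖ ^ 2 + ‖Y‖ ^ 2) := by
        rw [abs_of_nonneg (a := S * ‖X‖ ^ 2) (by positivity)]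
        have : S * ‖X‖ ^ 2 ≤ S * (‖X‖ ^ 2 + ‖Y‖ ^ 2) := by gcongr; linarith [sq_nonneg ‖Y‖]
        linarith
    _ = (1 + S) * (‖X‖ ^ 2 + ‖Y‖ ^ 2) := by ring
    _ ≤ (1 + S) * ((1 / u + 2) * (‖f p.1‖ ^ 2 + ‖f₁ p.1‖ ^ 2 + ‖f₂ p.1‖ ^ 2)) := by gcongr
    _ = _ := by ring

/-- At an inner vertex the terms add up to `⟪x, y + S x⟫`, which has nonnegative real part. At any
other vertex met by the fibre the function vanishes, and so does every term. -/
theorem SatisfiesBC.tsum_fiber_nonneg {F F₁ : A → ℝ → ℂ} (h : SatisfiesBC bc A F F₁) (v : V) :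
    0 ≤ ∑' p : {p : A × Bool // G.endVertex ((p.1 : E), p.2) = v},
      boundaryTerm G bc.S F F₁ p.1 := by
  by_cases hv : G.IsInner A v
  · obtain ⟨x, y, hx, hy, hb⟩ := h.1 v hv
    let φ : {p : A × Bool // G.endVertex ((p.1 : E), p.2) = v} ≃ G.Ends v :=
      { toFun := fun p => ⟨((p.1.1 : E), p.1.2), p.2⟩
        invFun := fun p => ⟨(⟨p.1.1, hv p.1 p.2⟩, p.1.2), p.2⟩
        left_inv := fun _ => rfl
        right_inv := fun _ => rfl }
    have hsum : HasSum (fun p : G.Ends v => (⟪x p, (y + (bc.S : ℂ) • x) p⟫_ℂ).re)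
        (⟪x, y + (bc.S : ℂ) • x⟫_ℂ).re :=
      (lp.hasSum_inner x (y + (bc.S : ℂ) • x)).mapL Complex.reCLM
    have e : ∀ p, boundaryTerm G bc.S F F₁ p.1 = (⟪x (φ p), (y + (bc.S : ℂ) • x) (φ p)⟫_ℂ).re := by
      intro p
      have h1 := hx (φ p) p.1.1.2
      have h2 := hy (φ p) p.1.1.2
      have h1' : F p.1.1 (G.endCoord ((p.1.1 : E), p.1.2)) = x (φ p) := h1
      have h2' : F₁ p.1.1 (G.endCoord ((p.1.1 : E), p.1.2)) =
        endSign ((p.1.1 : E), p.1.2) * y (φ p) := h2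
      unfold boundaryTerm
      rw [h1', h2', ← mul_assoc (endSign _), endSign_mul_self, one_mul, lp.coeFn_add, Pi.add_apply,
        inner_add_right, lp.coeFn_smul, Pi.smul_apply, inner_smul_right, Complex.add_re,
        Complex.re_ofReal_mul, RCLike.inner_apply, RCLike.inner_apply, mul_comm (y (φ p)),
        mul_comm (x (φ p)), re_conj_mul_self]
    rw [tsum_congr e, φ.tsum_eq (fun p => (⟪x p, (y + (bc.S : ℂ) • x) p⟫_ℂ).re), hsum.tsum_eq]
    exact hb.re_inner_ge
  · refine le_of_eq (Eq.symm ?_)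
    refine (tsum_congr fun p => ?_).trans tsum_zero
    have hbd : G.IsBoundary A v := by
      refine ⟨⟨((p.1.1 : E), p.1.2), p.2, p.1.1.2⟩, ?_⟩
      unfold MetricGraph.IsInner at hv
      push Not at hv
      exact hv
    have := h.2 v hbd ⟨((p.1.1 : E), p.1.2), p.2⟩ p.1.1.2
    have h' : F p.1.1 (G.endCoord ((p.1.1 : E), p.1.2)) = 0 := this
    unfold boundaryTerm
    rw [h']
    simp

/-- The operators with bounded potential are bounded from below. -/
theorem operatorGraph_re_inner_ge {u U : ℝ} (hG : G.LengthBounds u U) {ν : E → ℝ → ℝ} {q : E → ℝ}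
    {Q : ℝ} (hν : ∀ e, AEStronglyMeasurable (ν e) (G.edgeMeasure e))
    (hQ : ∀ e ∈ A, ∀ᵐ t ∂(G.edgeMeasure e), |q e * ν e t| ≤ Q) {f g : G.L2 A}
    (h : (f, g) ∈ operatorGraph G bc ν q A) :
    -(Q + 2 * bc.S * (1 / u + 2 * bc.S)) * ‖f‖ ^ 2 ≤ (⟪f, g⟫_ℂ).re := by
  obtain ⟨f₁, f₂, F, F₁, hr, hbc, hg⟩ := mem_operatorGraph_iff.1 h
  set M := Q + 2 * bc.S * (1 / u + 2 * bc.S) with hM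
  have hsm := hr.summable_boundaryTerm hG bc.S_pos
  have hsum : HasSum (fun e : A => (⟪f e, (g + (M : ℂ) • f) e⟫_ℂ).re)
      (⟪f, g + (M : ℂ) • f⟫_ℂ).re :=
    (lp.hasSum_inner f (g + (M : ℂ) • f)).mapL Complex.reCLM
  have hedge : ∀ e : A, ∑' b : Bool, boundaryTerm G bc.S F F₁ (e, b) ≤
      (⟪f e, (g + (M : ℂ) • f) e⟫_ℂ).re := by
    intro e
    have := (hr e).boundary_le (G.len_pos e) hG.1 (hG.2.2 e).1 bc.S_pos
      (W := fun t => q e * ν e t) ((hν e).const_mul _) (hQ e e.2) (hg e)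
    rw [tsum_bool, lp.coeFn_add, Pi.add_apply, inner_add_right, lp.coeFn_smul, Pi.smul_apply,
      inner_smul_right, Complex.add_re, Complex.re_ofReal_mul]
    have e4 : (⟪f e, f e⟫_ℂ).re = ‖f e‖ ^ 2 := by
      rw [inner_self_eq_norm_sq_to_K]; norm_cast
    rw [e4]
    refine le_trans (le_of_eq ?_) this
    simp [boundaryTerm, MetricGraph.endCoord, endSign]
  have hpos : 0 ≤ ∑' p, boundaryTerm G bc.S F F₁ p := by
    -- The same double sum is read per edge in `hedge` and per vertex here; nonnegativity is visible
    -- only per vertex.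
    let φ := Equiv.sigmaFiberEquiv (fun p : A × Bool => G.endVertex ((p.1 : E), p.2))
    have hs : Summable fun c => boundaryTerm G bc.S F F₁ (φ c) := φ.summable_iff.2 hsm
    rw [← φ.tsum_eq, hs.tsum_sigma]
    exact tsum_nonneg fun v => hbc.tsum_fiber_nonneg v
  rw [hsm.tsum_prod] at hpos
  have hle := Summable.tsum_le_tsum hedge hsm.prod hsum.summable
  rw [hsum.tsum_eq, inner_add_right, inner_smul_right, Complex.add_re, Complex.re_ofReal_mul]
    at hle
  have e4 : (⟪f, f⟫_ℂ).re = ‖f‖ ^ 2 := by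
    rw [inner_self_eq_norm_sq_to_K]; norm_cast
  rw [e4] at hle
  linarith

end Graph

/-! ### Resolvents of semibounded operators -/

section Abstract

variable {H : Type*} [NormedAddCommGroup H] [InnerProductSpace ℂ H] {T : Submodule ℂ (H × H)}
  {m : ℝ} {z : ℂ}

theorem re_inner_self (x : H) : (⟪x, x⟫_ℂ).re = ‖x‖ ^ 2 := by
  rw [inner_self_eq_norm_sq_to_K]; norm_cast

/-- Coercivity and Cauchy–Schwarz: `(m - Re z) ‖f‖² ≤ Re ⟪f, k⟫ ≤ ‖f‖ ‖k‖`. -/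
theorem norm_le_of_mem_graph (hm : ∀ fg ∈ T, m * ‖fg.1‖ ^ 2 ≤ (⟪fg.1, fg.2⟫_ℂ).re)
    (hz : z.re < m) {f k : H} (h : (f, k + z • f) ∈ T) : ‖f‖ ≤ (m - z.re)⁻¹ * ‖k‖ := by
  have h1 := hm _ h
  simp only at h1
  have e : (⟪f, z • f⟫_ℂ).re = z.re * ‖f‖ ^ 2 := by
    rw [inner_smul_right, inner_self_eq_norm_sq_to_K]
    have : z * ((‖f‖ : ℝ) : ℂ) ^ 2 = z * ((‖f‖ ^ 2 : ℝ) : ℂ) := by push_cast; rfl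
    exact (congrArg Complex.re this).trans (Complex.re_mul_ofReal _ _)
  rw [inner_add_right, Complex.add_re, e] at h1
  have h2 : (⟪f, k⟫_ℂ).re ≤ ‖f‖ * ‖k‖ :=
    (Complex.re_le_norm _).trans (norm_inner_le_norm f k)
  have hp : 0 < m - z.re := sub_pos.2 hz
  rw [inv_mul_eq_div, le_div_iff₀ hp]
  rcases eq_or_ne ‖f‖ 0 with h0 | h0
  · rw [h0, zero_mul]; positivity
  · have : 0 < ‖f‖ := lt_of_le_of_ne (norm_nonneg f) h0.symm
    refine le_of_mul_le_mul_left ?_ this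
    nlinarith

/-- The a priori estimate gives uniqueness of solutions, hence linearity of the solution map, and
its norm bound. Only solvability has to be assumed. -/
theorem exists_resolvent (hm : ∀ fg ∈ T, m * ‖fg.1‖ ^ 2 ≤ (⟪fg.1, fg.2⟫_ℂ).re)
    (hz : z.re < m) (hs : ∀ k, ∃ f, (f, k + z • f) ∈ T) :
    ∃ R : H →L[ℂ] H, (∀ k, (R k, k + z • R k) ∈ T) ∧
      (∀ f g, (f, g) ∈ T → R (g - z • f) = f) ∧ ‖R‖ ≤ (m - z.re)⁻¹ := by
  choose r hr using hs
  have huniq : ∀ {f f' k : H}, (f, k + z • f) ∈ T → (f', k + z • f') ∈ T → f = f' := by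
    intro f f' k h h'
    have h0 : (f - f', (0 : H) + z • (f - f')) ∈ T := by
      have := T.sub_mem h h'
      rwa [Prod.mk_sub_mk, show k + z • f - (k + z • f') = 0 + z • (f - f') by
        rw [smul_sub]; abel] at this
    have := norm_le_of_mem_graph hm hz h0
    rw [norm_zero, mul_zero, norm_le_zero_iff] at this
    exact sub_eq_zero.1 this
  let R₀ : H →ₗ[ℂ] H :=
    { toFun := r
      map_add' := fun x y => huniq (hr _) (by
        have := T.add_mem (hr x) (hr y)
        rwa [Prod.mk_add_mk, show x + z • r x + (y + z • r y) = x + y + z • (r x + r y) by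
          rw [smul_add]; abel] at this)
      map_smul' := fun c x => huniq (hr _) (by
        have := T.smul_mem c (hr x)
        rwa [Prod.smul_mk, smul_add, smul_comm c z] at this) }
  have hb : ∀ k, ‖R₀ k‖ ≤ (m - z.re)⁻¹ * ‖k‖ := fun k => norm_le_of_mem_graph hm hz (hr k)
  refine ⟨R₀.mkContinuous _ hb, hr, fun f g h => huniq (hr _) ?_,
    R₀.mkContinuous_norm_le (by have := sub_pos.2 hz; positivity) hb⟩
  rwa [sub_add_cancel]

/-- Bounded perturbations of norm less than the distance to the lower bound. -/
theorem exists_mem_graph_perturbation [CompleteSpace H]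
    (hm : ∀ fg ∈ T, m * ‖fg.1‖ ^ 2 ≤ (⟪fg.1, fg.2⟫_ℂ).re)
    (hz : z.re < m) (hs : ∀ k, ∃ f, (f, k + z • f) ∈ T) {W : H →L[ℂ] H} (hW : ‖W‖ < m - z.re)
    (k : H) : ∃ f, (f, k + z • f - W f) ∈ T := by
  obtain ⟨R, hR, -, hRn⟩ := exists_resolvent hm hz hs
  have hp : 0 < m - z.re := sub_pos.2 hz
  have hn : ‖-(W * R)‖ < 1 := by
    rw [norm_neg]
    calc ‖W * R‖ ≤ ‖W‖ * ‖R‖ := norm_mul_le _ _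
      _ ≤ ‖W‖ * (m - z.re)⁻¹ := by gcongr
      _ < 1 := by rw [← div_eq_mul_inv, div_lt_one hp]; exact hW
  -- `B` inverts `1 + W R` from the right, so `R (B k)` solves the perturbed equation.
  obtain ⟨B, hB⟩ := (isUnit_one_sub_of_norm_lt_one hn).exists_right_inv
  refine ⟨R (B k), ?_⟩
  have e : B k + W (R (B k)) = k := by
    have := congrArg (fun D : H →L[ℂ] H => D k) hB
    simpa using this
  have e2 : k + z • R (B k) - W (R (B k)) = B k + z • R (B k) := by
    nth_rw 1 [← e]; abel
  rw [e2]
  exact hR _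

/-- From a point `-κ` where the equation is solvable, a Neumann series reaches the open disc of
radius `m + κ` around it. As `κ` grows these discs exhaust the half plane `Re z < m`, so solvability
far to the left is enough. -/
theorem notMem_opSpectrum_of_re_lt [CompleteSpace H]
    (hm : ∀ fg ∈ T, m * ‖fg.1‖ ^ 2 ≤ (⟪fg.1, fg.2⟫_ℂ).re) {κ₀ : ℝ}
    (hs : ∀ κ : ℝ, κ₀ ≤ κ → ∀ k, ∃ f, (f, k + (-κ : ℂ) • f) ∈ T) (hz : z.re < m) :
    z ∉ opSpectrum (T : Set (H × H)) := by
  have hp : 0 < m - z.re := sub_pos.2 hz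
  -- The quadratic condition is `|z + κ|² < (m + κ)²`, expanded and factored.
  obtain ⟨κ, h1, h2, h3, h4⟩ : ∃ κ : ℝ, κ₀ ≤ κ ∧ -m < κ ∧
      z.im ^ 2 < (m - z.re) * (m + z.re + 2 * κ) ∧ 0 ≤ κ := by
    have t : Tendsto (fun κ : ℝ => (m - z.re) * (m + z.re + 2 * κ)) atTop atTop :=
      Tendsto.const_mul_atTop hp
        (tendsto_atTop_add_const_left _ _ (tendsto_id.const_mul_atTop two_pos))
    exact ((eventually_ge_atTop κ₀).and ((eventually_gt_atTop (-m)).and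
      ((t.eventually_gt_atTop (z.im ^ 2)).and (eventually_ge_atTop 0)))).exists
  have hn : ‖((-κ : ℂ) - z)‖ < m - (-κ : ℂ).re := by
    have hre : (-κ : ℂ).re = -κ := by simp
    rw [hre]
    refine lt_of_pow_lt_pow_left₀ 2 (by linarith) ?_
    rw [← Complex.normSq_eq_norm_sq, Complex.normSq_apply]
    simp only [Complex.sub_re, Complex.neg_re, Complex.ofReal_re, Complex.sub_im, Complex.neg_im,
      Complex.ofReal_im]
    nlinarith
  have hW : ‖((-κ : ℂ) - z) • (1 : H →L[ℂ] H)‖ < m - (-κ : ℂ).re := by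
    refine lt_of_le_of_lt ((norm_smul_le _ _).trans ?_) hn
    exact mul_le_of_le_one_right (norm_nonneg _) ContinuousLinearMap.norm_id_le
  have hsurj : ∀ k, ∃ f, (f, k + z • f) ∈ T := by
    intro k
    obtain ⟨f, hf⟩ := exists_mem_graph_perturbation hm (by simp; linarith) (hs κ h1) hW k
    refine ⟨f, ?_⟩
    convert hf using 2
    simp only [sub_smul, sub_apply, smul_apply,
      one_apply_eq_self]
    abel
  obtain ⟨R, hR1, hR2, -⟩ := exists_resolvent hm hz hsurj
  exact fun h => h ⟨R, hR1, hR2⟩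

end Abstract

/-! ### The operator graph is a linear subspace -/

section Linear

variable {E V : Type*} {G : MetricGraph E V} {bc : BoundaryCondition G} {A : Set E}

theorem IsEdgeRep.add {l : ℝ} {f f₁ f₂ g g₁ g₂ : Lp ℂ 2 (volume.restrict (Set.Ioo 0 l))}
    {F F₁ K K₁ : ℝ → ℂ} (h : IsEdgeRep l f f₁ f₂ F F₁) (h' : IsEdgeRep l g g₁ g₂ K K₁) :
    IsEdgeRep l (f + g : Lp ℂ 2 (volume.restrict (Set.Ioo 0 l)))
      (f₁ + g₁ : Lp ℂ 2 (volume.restrict (Set.Ioo 0 l)))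
      (f₂ + g₂ : Lp ℂ 2 (volume.restrict (Set.Ioo 0 l)))
      (fun t => F t + K t) (fun t => F₁ t + K₁ t) where
  prim := h.prim.add h'.prim
  prim₁ := (h.prim₁.add h'.prim₁).congr_deriv (by
    filter_upwards [Lp.coeFn_add f₂ g₂] with t ht; rw [ht]; rfl)
  eq := by
    filter_upwards [Lp.coeFn_add f g, h.eq, h'.eq] with t h1 h2 h3
    rw [h1, Pi.add_apply, h2, h3]
  eq₁ := by
    filter_upwards [Lp.coeFn_add f₁ g₁, h.eq₁, h'.eq₁] with t h1 h2 h3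
    rw [h1, Pi.add_apply, h2, h3]

theorem IsEdgeRep.const_smul {l : ℝ} {f f₁ f₂ : Lp ℂ 2 (volume.restrict (Set.Ioo 0 l))}
    {F F₁ : ℝ → ℂ} (h : IsEdgeRep l f f₁ f₂ F F₁) (c : ℂ) :
    IsEdgeRep l (c • f : Lp ℂ 2 (volume.restrict (Set.Ioo 0 l)))
      (c • f₁ : Lp ℂ 2 (volume.restrict (Set.Ioo 0 l)))
      (c • f₂ : Lp ℂ 2 (volume.restrict (Set.Ioo 0 l)))
      (fun t => c * F t) (fun t => c * F₁ t) where
  prim := h.prim.const_mul c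
  prim₁ := (h.prim₁.const_mul c).congr_deriv (by
    filter_upwards [Lp.coeFn_smul c f₂] with t ht; rw [ht]; rfl)
  eq := by
    filter_upwards [Lp.coeFn_smul c f, h.eq] with t h1 h2
    rw [h1, Pi.smul_apply, h2, smul_eq_mul]
  eq₁ := by
    filter_upwards [Lp.coeFn_smul c f₁, h.eq₁] with t h1 h2
    rw [h1, Pi.smul_apply, h2, smul_eq_mul]

theorem BoundaryCondition.Holds.add {v : V} {x y x' y' : G.VertexSpace v} (h : bc.Holds v x y)
    (h' : bc.Holds v x' y') : bc.Holds v (x + x') (y + y') := by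
  obtain ⟨z, hz, hL⟩ := h
  obtain ⟨z', hz', hL'⟩ := h'
  refine ⟨z + z', ?_, ?_⟩
  · rw [Submodule.coe_add, Submodule.coe_add, hz, hz']
  · rw [LinearPMap.map_add, Submodule.coe_add, hL, hL', map_add]; abel

theorem BoundaryCondition.Holds.const_smul {v : V} {x y : G.VertexSpace v} (h : bc.Holds v x y)
    (c : ℂ) : bc.Holds v (c • x) (c • y) := by
  obtain ⟨z, hz, hL⟩ := h
  refine ⟨c • z, ?_, ?_⟩
  · rw [Submodule.coe_smul, Submodule.coe_smul, hz]
  · rw [LinearPMap.map_smul, Submodule.coe_smul, hL, map_smul, smul_sub]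

theorem BoundaryCondition.holds_zero (v : V) : bc.Holds v 0 0 :=
  ⟨0, rfl, by rw [LinearPMap.map_zero, map_zero, sub_zero]; rfl⟩

theorem SatisfiesBC.add {F F₁ K K₁ : A → ℝ → ℂ} (h : SatisfiesBC bc A F F₁)
    (h' : SatisfiesBC bc A K K₁) :
    SatisfiesBC bc A (fun e t => F e t + K e t) (fun e t => F₁ e t + K₁ e t) := by
  refine ⟨fun v hv => ?_, fun v hv p hp => ?_⟩
  · obtain ⟨x, y, hx, hy, hb⟩ := h.1 v hv
    obtain ⟨x', y', hx', hy', hb'⟩ := h'.1 v hv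
    refine ⟨x + x', y + y', fun p hp => ?_, fun p hp => ?_, hb.add hb'⟩
    · exact congrArg₂ (· + ·) (hx p hp) (hx' p hp)
    · exact (congrArg₂ (· + ·) (hy p hp) (hy' p hp)).trans (mul_add _ _ _).symm
  · exact (congrArg₂ (· + ·) (h.2 v hv p hp) (h'.2 v hv p hp)).trans (add_zero 0)

theorem SatisfiesBC.const_smul {F F₁ : A → ℝ → ℂ} (h : SatisfiesBC bc A F F₁) (c : ℂ) :
    SatisfiesBC bc A (fun e t => c * F e t) (fun e t => c * F₁ e t) := by
  refine ⟨fun v hv => ?_, fun v hv p hp => ?_⟩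
  · obtain ⟨x, y, hx, hy, hb⟩ := h.1 v hv
    refine ⟨c • x, c • y, fun p hp => ?_, fun p hp => ?_, hb.const_smul c⟩
    · exact congrArg (c * ·) (hx p hp)
    · exact (congrArg (c * ·) (hy p hp)).trans (mul_left_comm _ _ _)
  · exact (congrArg (c * ·) (h.2 v hv p hp)).trans (mul_zero c)

theorem satisfiesBC_zero : SatisfiesBC bc A (fun _ _ => 0) (fun _ _ => 0) :=
  ⟨fun v _ => ⟨0, 0, fun _ _ => rfl, fun _ _ => (mul_zero _).symm, bc.holds_zero v⟩,
    fun _ _ _ _ => rfl⟩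

/-- `operatorGraph` as a linear subspace. -/
def operatorSubmodule (G : MetricGraph E V) (bc : BoundaryCondition G) (ν : E → ℝ → ℝ)
    (q : E → ℝ) (A : Set E) : Submodule ℂ (G.L2 A × G.L2 A) where
  carrier := operatorGraph G bc ν q A
  add_mem' := by
    intro x y hx hy
    obtain ⟨f₁, f₂, F, F₁, hr, hbc, hg⟩ := mem_operatorGraph_iff.1 hx
    obtain ⟨f₁', f₂', F', F₁', hr', hbc', hg'⟩ := mem_operatorGraph_iff.1 hy
    refine mem_operatorGraph_iff.2 ⟨f₁ + f₁', f₂ + f₂', _, _,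
      fun e => (hr e).add (hr' e), hbc.add hbc', fun e => ?_⟩
    filter_upwards [hg e, hg' e, Lp.coeFn_add (x.2 e) (y.2 e), Lp.coeFn_add (x.1 e) (y.1 e),
      Lp.coeFn_add (f₂ e) (f₂' e)] with t h1 h2 h3 h4 h5
    have h3' : ((x + y).2 e : ℝ → ℂ) t = x.2 e t + y.2 e t := h3
    have h4' : ((x + y).1 e : ℝ → ℂ) t = x.1 e t + y.1 e t := h4
    have h5' : ((f₂ + f₂') e : ℝ → ℂ) t = f₂ e t + f₂' e t := h5
    rw [h3', h4', h5', h1, h2]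
    ring
  zero_mem' := by
    refine mem_operatorGraph_iff.2 ⟨0, 0, fun _ _ => 0, fun _ _ => 0, fun e => ?_,
      satisfiesBC_zero, fun e => ?_⟩
    · have h0 : ((0 : Lp ℂ 2 (G.edgeMeasure e)) : ℝ → ℂ) =ᵐ[G.edgeMeasure e] 0 :=
        Lp.coeFn_zero ℂ 2 (G.edgeMeasure e)
      exact ⟨isPrim_const 0, (isPrim_const 0).congr_deriv (h0.mono fun t ht => ht.symm), h0, h0⟩
    · have h0 : ((0 : Lp ℂ 2 (G.edgeMeasure e)) : ℝ → ℂ) =ᵐ[G.edgeMeasure e] 0 :=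
        Lp.coeFn_zero ℂ 2 (G.edgeMeasure e)
      filter_upwards [h0] with t ht
      change ((0 : Lp ℂ 2 (G.edgeMeasure e)) : ℝ → ℂ) t =
        -((0 : Lp ℂ 2 (G.edgeMeasure e)) : ℝ → ℂ) t + _ * ((0 : Lp ℂ 2 (G.edgeMeasure e)) : ℝ → ℂ) t
      rw [ht]; simp
  smul_mem' := by
    intro c x hx
    obtain ⟨f₁, f₂, F, F₁, hr, hbc, hg⟩ := mem_operatorGraph_iff.1 hx
    refine mem_operatorGraph_iff.2 ⟨c • f₁, c • f₂, _, _,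
      fun e => (hr e).const_smul c, hbc.const_smul c, fun e => ?_⟩
    filter_upwards [hg e, Lp.coeFn_smul c (x.2 e), Lp.coeFn_smul c (x.1 e),
      Lp.coeFn_smul c (f₂ e)] with t h1 h3 h4 h5
    have h3' : ((c • x).2 e : ℝ → ℂ) t = c * x.2 e t := h3
    have h4' : ((c • x).1 e : ℝ → ℂ) t = c * x.1 e t := h4
    have h5' : ((c • f₂) e : ℝ → ℂ) t = c * f₂ e t := h5
    rw [h3', h4', h5', h1]
    ring

theorem coe_operatorSubmodule (ν : E → ℝ → ℝ) (q : E → ℝ) :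
    (operatorSubmodule G bc ν q A : Set (G.L2 A × G.L2 A)) = operatorGraph G bc ν q A := rfl

theorem mem_operatorSubmodule {ν : E → ℝ → ℝ} {q : E → ℝ} {fg : G.L2 A × G.L2 A} :
    fg ∈ operatorSubmodule G bc ν q A ↔ fg ∈ operatorGraph G bc ν q A := Iff.rfl

/-! ### Multiplication operators -/

theorem memLp_mul_of_bound {μ : Measure ℝ} (f : Lp ℂ 2 μ) {w : ℝ → ℝ} {Q : ℝ}
    (hw : AEStronglyMeasurable w μ) (hQ : ∀ᵐ t ∂μ, |w t| ≤ Q) :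
    MemLp (fun t => (w t : ℂ) * f t) 2 μ := by
  refine (Lp.memLp f).of_le_mul (c := Q)
    ((Complex.continuous_ofReal.comp_aestronglyMeasurable hw).mul (Lp.memLp f).1) ?_
  filter_upwards [hQ] with t ht
  rw [norm_mul, Complex.norm_real, Real.norm_eq_abs]
  gcongr

theorem exists_mulOperator_Lp {μ : Measure ℝ} {w : ℝ → ℝ} {Q : ℝ}
    (hw : AEStronglyMeasurable w μ) (hQ : ∀ᵐ t ∂μ, |w t| ≤ Q) :
    ∃ W : Lp ℂ 2 μ →ₗ[ℂ] Lp ℂ 2 μ, (∀ f, ‖W f‖ ≤ Q * ‖f‖) ∧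
      ∀ f, ∀ᵐ t ∂μ, (W f : ℝ → ℂ) t = (w t : ℂ) * (f : ℝ → ℂ) t := by
  let r : Lp ℂ 2 μ → Lp ℂ 2 μ := fun f => (memLp_mul_of_bound f hw hQ).toLp _
  have hr : ∀ f, (r f : ℝ → ℂ) =ᵐ[μ] fun t => (w t : ℂ) * (f : ℝ → ℂ) t :=
    fun f => MemLp.coeFn_toLp _
  refine ⟨{ toFun := r, map_add' := fun f g => Lp.ext ?_, map_smul' := fun c f => Lp.ext ?_ },
    fun f => ?_, hr⟩
  · filter_upwards [hr (f + g), hr f, hr g, Lp.coeFn_add (r f) (r g), Lp.coeFn_add f g]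
      with t h1 h2 h3 h4 h5
    rw [h1, h4, Pi.add_apply, h2, h3, h5, Pi.add_apply, mul_add]
  · filter_upwards [hr (c • f), hr f, Lp.coeFn_smul c (r f), Lp.coeFn_smul c f] with t h1 h2 h4 h5
    rw [h1, RingHom.id_apply, h4, Pi.smul_apply, h2, h5, Pi.smul_apply, smul_eq_mul, smul_eq_mul]
    ring
  · refine Lp.norm_le_mul_norm_of_ae_le_mul ?_
    filter_upwards [hr f, hQ] with t h1 h2
    refine (congrArg norm h1).trans_le ?_
    rw [norm_mul, Complex.norm_real, Real.norm_eq_abs]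
    gcongr

theorem exists_diagonal_lp {ι : Type*} {B : ι → Type*} [∀ i, NormedAddCommGroup (B i)]
    [∀ i, NormedSpace ℂ (B i)] {Q : ℝ} (hQ : 0 ≤ Q) (T : ∀ i, B i →ₗ[ℂ] B i)
    (hT : ∀ i x, ‖T i x‖ ≤ Q * ‖x‖) :
    ∃ W : lp B 2 →L[ℂ] lp B 2, ‖W‖ ≤ Q ∧ ∀ f i, W f i = T i (f i) := by
  have hmem : ∀ f : lp B 2, Memℓp (fun i => T i (f i)) 2 := fun f =>
    ((lp.memℓp f).norm.const_mul Q).mono fun i => hT i _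
  let W₀ : lp B 2 →ₗ[ℂ] lp B 2 :=
    { toFun := fun f => ⟨fun i => T i (f i), hmem f⟩
      map_add' := fun f g => lp.ext (funext fun i => (T i).map_add (f i) (g i))
      map_smul' := fun c f => lp.ext (funext fun i => (T i).map_smul c (f i)) }
  have hb : ∀ f, ‖W₀ f‖ ≤ Q * ‖f‖ := by
    intro f
    have : ‖W₀ f‖ ≤ ‖(Q : ℂ) • f‖ := lp.norm_mono (by norm_num) fun i => by
      rw [lp.coeFn_smul, Pi.smul_apply, norm_smul, Complex.norm_real, Real.norm_eq_abs,
        abs_of_nonneg hQ]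
      exact hT i (f i)
    rwa [norm_smul, Complex.norm_real, Real.norm_eq_abs, abs_of_nonneg hQ] at this
  exact ⟨W₀.mkContinuous Q hb, W₀.mkContinuous_norm_le hQ hb, fun _ _ => rfl⟩

theorem exists_mulOperator {w : E → ℝ → ℝ} {Q : ℝ} (hQ0 : 0 ≤ Q)
    (hw : ∀ e, AEStronglyMeasurable (w e) (G.edgeMeasure e))
    (hQ : ∀ e ∈ A, ∀ᵐ t ∂(G.edgeMeasure e), |w e t| ≤ Q) :
    ∃ W : G.L2 A →L[ℂ] G.L2 A, ‖W‖ ≤ Q ∧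
      ∀ (f : G.L2 A) (e : A), ∀ᵐ t ∂(G.edgeMeasure e),
        (W f e : ℝ → ℂ) t = (w e t : ℂ) * (f e : ℝ → ℂ) t := by
  choose T hT hTe using fun e : A => exists_mulOperator_Lp (hw e) (hQ e e.2)
  obtain ⟨W, hW, hWe⟩ := exists_diagonal_lp hQ0 T hT
  exact ⟨W, hW, fun f e => by rw [hWe]; exact hTe e (f e)⟩

end Linear

/-! ### Solving the free equation -/

section ODE

variable {l : ℝ}

/-- The solution of `p' = c p - g`, `p 0 = p₀`. -/
def expSol (c : ℝ) (g : ℝ → ℂ) (p₀ : ℂ) (t : ℝ) : ℂ :=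
  (Real.exp (c * t) : ℂ) * (p₀ - ∫ s in (0 : ℝ)..t, (Real.exp (-(c * s)) : ℂ) * g s)

theorem expSol_zero (c : ℝ) (g : ℝ → ℂ) (p₀ : ℂ) : expSol c g p₀ 0 = p₀ := by
  simp [expSol]

theorem expSol_eq_add (c : ℝ) (g : ℝ → ℂ) (p₀ : ℂ) (t : ℝ) :
    expSol c g p₀ t = (Real.exp (c * t) : ℂ) * p₀ + expSol c g 0 t := by
  unfold expSol; ring

theorem isPrim_expSol (c : ℝ) {g : ℝ → ℂ} (hg : IntegrableOn g (Set.Ioo 0 l)) (p₀ : ℂ) :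
    IsPrim l (expSol c g p₀) (fun t => c * expSol c g p₀ t - g t) := by
  have hexp : ∀ a : ℝ, ContinuousOn (fun s : ℝ => (Real.exp (a * s) : ℂ)) (Set.Icc 0 l) := fun a =>
    (Complex.continuous_ofReal.comp (Real.continuous_exp.comp
      (continuous_const.mul continuous_id))).continuousOn
  have hi : IntegrableOn (fun s => (Real.exp (-(c * s)) : ℂ) * g s) (Set.Ioo 0 l) := by
    have h := hexp (-c)
    rw [← integrableOn_Icc_iff_integrableOn_Ioo] at hg ⊢
    simpa only [neg_mul] using hg.continuousOn_mul h isCompact_Icc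
  have h1 : IsPrim l (fun t => (Real.exp (c * t) : ℂ))
      (fun t => ((Real.exp (c * t) * c : ℝ) : ℂ)) := by
    refine isPrim_of_hasDerivAt (fun t _ => ?_) ?_
    · have := ((hasDerivAt_id t).const_mul c).exp.ofReal_comp
      simpa using this
    · simp only [Complex.ofReal_mul]
      exact (hexp c).mul continuousOn_const
  have h2 := ((isPrim_const (l := l) p₀).sub (isPrim_primitive hi 0))
  have h3 := h1.mul h2
  have e : (fun t => (Real.exp (c * t) : ℂ) *
      (p₀ - (0 + ∫ s in (0 : ℝ)..t, (Real.exp (-(c * s)) : ℂ) * g s))) = expSol c g p₀ := by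
    funext t; simp [expSol]
  rw [e] at h3
  refine h3.congr_deriv (Eventually.of_forall fun t => ?_)
  have hee : (Real.exp (c * t) : ℂ) * (Real.exp (-(c * t)) : ℂ) = 1 := by
    rw [← Complex.ofReal_mul, ← Real.exp_add, add_neg_cancel, Real.exp_zero, Complex.ofReal_one]
  simp only [expSol, zero_add, zero_sub, Complex.ofReal_mul]
  linear_combination (-g t) * hee

/-- The solution of `-F'' + κ² F = g` with initial values `F 0 = a`, `F' 0 = b`. -/
def freeSol (κ : ℝ) (g : ℝ → ℂ) (a b : ℂ) (t : ℝ) : ℂ :=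
  (2 * κ : ℂ)⁻¹ * (expSol κ g (b + κ * a) t - expSol (-κ) g (b - κ * a) t)

/-- The derivative of `freeSol`. -/
def freeSolDeriv (κ : ℝ) (g : ℝ → ℂ) (a b : ℂ) (t : ℝ) : ℂ :=
  2⁻¹ * (expSol κ g (b + κ * a) t + expSol (-κ) g (b - κ * a) t)

theorem freeSol_zero {κ : ℝ} (hκ : 0 < κ) (g : ℝ → ℂ) (a b : ℂ) : freeSol κ g a b 0 = a := by
  have : (κ : ℂ) ≠ 0 := by exact_mod_cast hκ.ne'
  rw [freeSol, expSol_zero, expSol_zero]; field_simp; ring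

/-- If `F'' = κ² F - g`, then `p = F' ± κ F` solves the first-order equation `p' = ± κ p - g`; `F`
and `F'` are recovered from the difference and the sum of the two. -/
theorem isPrim_freeSol {κ : ℝ} (hκ : 0 < κ) {g : ℝ → ℂ} (hg : IntegrableOn g (Set.Ioo 0 l))
    (a b : ℂ) : IsPrim l (freeSol κ g a b) (freeSolDeriv κ g a b) ∧
      IsPrim l (freeSolDeriv κ g a b) (fun t => κ ^ 2 * freeSol κ g a b t - g t) := by
  have hk : (κ : ℂ) ≠ 0 := by exact_mod_cast hκ.ne'
  have h1 := isPrim_expSol κ hg (b + κ * a)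
  have h2 := isPrim_expSol (-κ) hg (b - κ * a)
  constructor
  · refine ((h1.sub h2).const_mul (2 * κ : ℂ)⁻¹).congr_deriv (Eventually.of_forall fun t => ?_)
    simp only [freeSolDeriv, Complex.ofReal_neg]
    field_simp
    ring
  · refine ((h1.add h2).const_mul 2⁻¹).congr_deriv (Eventually.of_forall fun t => ?_)
    simp only [freeSol, Complex.ofReal_neg]
    field_simp
    ring

/-- Superposition: the initial values enter only through the homogeneous solution, so the boundary
conditions become an affine system for them. -/
theorem freeSol_add (κ : ℝ) (g : ℝ → ℂ) (a b : ℂ) (t : ℝ) :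
    freeSol κ g a b t = freeSol κ 0 a b t + freeSol κ g 0 0 t := by
  unfold freeSol
  rw [expSol_eq_add κ g, expSol_eq_add (-κ) g, expSol_eq_add κ 0, expSol_eq_add (-κ) 0,
    expSol_eq_add κ g (0 + κ * 0), expSol_eq_add (-κ) g (0 - κ * 0)]
  simp [expSol]
  ring

theorem freeSolDeriv_add (κ : ℝ) (g : ℝ → ℂ) (a b : ℂ) (t : ℝ) :
    freeSolDeriv κ g a b t = freeSolDeriv κ 0 a b t + freeSolDeriv κ g 0 0 t := by
  unfold freeSolDeriv
  rw [expSol_eq_add κ g, expSol_eq_add (-κ) g, expSol_eq_add κ 0, expSol_eq_add (-κ) 0,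
    expSol_eq_add κ g (0 + κ * 0), expSol_eq_add (-κ) g (0 - κ * 0)]
  simp [expSol]
  ring

theorem exists_isEdgeRep_freeSol (hl : 0 < l) {κ : ℝ} (hκ : 0 < κ)
    (k : Lp ℂ 2 (volume.restrict (Set.Ioo 0 l))) {g : ℝ → ℂ}
    (hg : ∀ᵐ t ∂(volume.restrict (Set.Ioo 0 l)), k t = g t) (a b : ℂ) :
    ∃ f f₁ : Lp ℂ 2 (volume.restrict (Set.Ioo 0 l)),
      IsEdgeRep l f f₁ ((κ ^ 2 : ℂ) • f - k : Lp ℂ 2 (volume.restrict (Set.Ioo 0 l)))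
        (freeSol κ g a b) (freeSolDeriv κ g a b) := by
  obtain ⟨h1, h2⟩ := isPrim_freeSol hκ ((integrableOn_of_Lp k).congr hg) a b
  have m1 := memLp_of_continuousOn (h1.continuousOn hl.le)
  have m2 := memLp_of_continuousOn (h2.continuousOn hl.le)
  refine ⟨m1.toLp _, m2.toLp _, h1, h2.congr_deriv ?_, m1.coeFn_toLp, m2.coeFn_toLp⟩
  filter_upwards [Lp.coeFn_sub ((κ ^ 2 : ℂ) • m1.toLp _) k, Lp.coeFn_smul (κ ^ 2 : ℂ) (m1.toLp _),
    m1.coeFn_toLp, hg] with t e1 e2 e3 e4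
  rw [e1, Pi.sub_apply, e2, Pi.smul_apply, e3, smul_eq_mul, e4]

/-- With `a = 0` the solution is `b sinh(κ t) / κ`, and `sinh(κ l) ≠ 0`. Hence a vanishing solution
has vanishing initial values. -/
theorem freeSol_homogeneous_eq_zero (hl : 0 < l) {κ : ℝ} (hκ : 0 < κ) {a b : ℂ}
    (h0 : freeSol κ 0 a b 0 = 0) (h1 : freeSol κ 0 a b l = 0) : a = 0 ∧ b = 0 := by
  have ha : a = 0 := by rwa [freeSol_zero hκ] at h0
  refine ⟨ha, ?_⟩
  have hk : (κ : ℂ) ≠ 0 := by exact_mod_cast hκ.ne'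
  have hne : (Real.exp (κ * l) : ℂ) - (Real.exp (-κ * l) : ℂ) ≠ 0 := by
    rw [← Complex.ofReal_sub]
    have : Real.exp (-κ * l) < Real.exp (κ * l) := Real.exp_lt_exp.2 (by nlinarith [mul_pos hκ hl])
    exact_mod_cast (sub_pos.2 this).ne'
  have e : freeSol κ 0 a b l =
      (2 * κ : ℂ)⁻¹ * (((Real.exp (κ * l) : ℂ) - (Real.exp (-κ * l) : ℂ)) * b) := by
    rw [ha]
    simp [freeSol, expSol]
    exact Or.inl (by ring)
  rw [e] at h1
  exact (mul_eq_zero.1 ((mul_eq_zero.1 h1).resolve_left (by simp [hk]))).resolve_left hne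

end ODE

/-! ### The boundary conditions on a finite subgraph as a linear system -/

section Boundary

variable {E V : Type*} {G : MetricGraph E V} {bc : BoundaryCondition G} {A : Set E}

theorem finiteDimensional_vertexSpace (v : V) [Finite (G.Ends v)] :
    FiniteDimensional ℂ (G.VertexSpace v) := by
  let φ : G.VertexSpace v →ₗ[ℂ] (G.Ends v → ℂ) :=
    { toFun := fun x => x, map_add' := fun _ _ => rfl, map_smul' := fun _ _ => rfl }
  exact FiniteDimensional.of_injective φ fun x y h => lp.ext h

/-- The conditions `P x = 0` and `L x = (1 - P) y` take values in the complementary subspaces `ran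
P` and `ker P`, so their sum is one equation in `ℓ²(E_v)` with as many scalar components as there
are ends at `v`. -/
theorem BoundaryCondition.exists_linearMap_holds (bc : BoundaryCondition G) (v : V)
    [Finite (G.Ends v)] :
    ∃ B : G.VertexSpace v × G.VertexSpace v →ₗ[ℂ] G.VertexSpace v,
      ∀ x y, B (x, y) = 0 → bc.Holds v x y := by
  have := finiteDimensional_vertexSpace (G := G) v
  -- The domain is dense, and in finite dimension every subspace is closed.
  have hdom : (bc.L v).domain = ⊤ := by
    have hd := (bc.isSelfAdjoint v).dense_domain
    have hc : IsClosed ((bc.L v).domain : Set (bc.P v).ker) :=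
      Submodule.closed_of_finiteDimensional _
    exact SetLike.coe_injective (by rw [← hc.closure_eq, hd.closure_eq]; rfl)
  have hidem : ∀ x, bc.P v (bc.P v x) = bc.P v x := fun x =>
    congrArg (fun D : G.VertexSpace v →L[ℂ] G.VertexSpace v => D x)
      (bc.isStarProjection v).isIdempotentElem
  let P : G.VertexSpace v →ₗ[ℂ] G.VertexSpace v := bc.P v
  let π : G.VertexSpace v →ₗ[ℂ] (bc.P v).ker :=
    (LinearMap.id - P).codRestrict _ fun x => by
      change bc.P v (x - bc.P v x) = 0
      rw [map_sub, hidem, sub_self]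
  let L' : (bc.P v).ker →ₗ[ℂ] (bc.P v).ker :=
    (bc.L v).toFun ∘ₗ (LinearEquiv.ofTop _ hdom).symm.toLinearMap
  let B : G.VertexSpace v × G.VertexSpace v →ₗ[ℂ] G.VertexSpace v :=
    P ∘ₗ LinearMap.fst ℂ _ _ + (Submodule.subtype _ ∘ₗ L' ∘ₗ π) ∘ₗ LinearMap.fst ℂ _ _ -
      (LinearMap.id - P) ∘ₗ LinearMap.snd ℂ _ _
  refine ⟨B, fun x y h => ?_⟩
  have hB : bc.P v x + ((L' (π x) : (bc.P v).ker) : G.VertexSpace v) - (y - bc.P v y) = 0 := h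
  have hker : bc.P v ((L' (π x) : (bc.P v).ker) : G.VertexSpace v) = 0 := (L' (π x)).2
  -- Applying `P v` to the equation leaves only the component in its range.
  have hx : bc.P v x = 0 := by
    have := congrArg (bc.P v) hB
    rwa [map_sub, map_add, map_sub, hidem, hidem, hker, sub_self, map_zero, add_zero,
      sub_zero] at this
  refine ⟨(LinearEquiv.ofTop _ hdom).symm (π x), ?_, ?_⟩
  · change x - bc.P v x = x
    rw [hx, sub_zero]
  · rw [hx, zero_add, sub_eq_zero] at hB
    exact hB

theorem finite_ends_of_isInner [Finite A] {v : V} (hv : G.IsInner A v) : Finite (G.Ends v) :=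
  Finite.of_injective (β := A × Bool) (fun p => (⟨p.1.1, hv p.1 p.2⟩, p.1.2)) fun p q h => by
    have h1 := congrArg (fun z : A × Bool => ((z.1 : E), z.2)) h
    exact Subtype.ext h1

/-- On a finite subgraph, the boundary conditions are a square linear system for the boundary
values. -/
theorem exists_boundaryMap (bc : BoundaryCondition G) (A : Set E) [Finite A] :
    ∃ B : (A × Bool → ℂ) × (A × Bool → ℂ) →ₗ[ℂ] (A × Bool → ℂ), ∀ F F₁ : A → ℝ → ℂ,
      B (fun p => F p.1 (G.endCoord ((p.1 : E), p.2)),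
        fun p => endSign ((p.1 : E), p.2) * F₁ p.1 (G.endCoord ((p.1 : E), p.2))) = 0 →
      SatisfiesBC bc A F F₁ := by
  classical
  choose b hb using fun (v : V) (hv : G.IsInner A v) =>
    have := finite_ends_of_isInner hv
    bc.exists_linearMap_holds v
  let r : ∀ (v : V) (hv : G.IsInner A v), (A × Bool → ℂ) →ₗ[ℂ] G.VertexSpace v := fun v hv =>
    have := finite_ends_of_isInner hv
    { toFun := fun X => ⟨fun p => X (⟨p.1.1, hv p.1 p.2⟩, p.1.2), Memℓp.all _⟩
      map_add' := fun _ _ => rfl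
      map_smul' := fun _ _ => rfl }
  let ev : ∀ (v : V) (p : G.Ends v), G.VertexSpace v →ₗ[ℂ] ℂ := fun v p =>
    { toFun := fun x => x p
      map_add' := fun _ _ => rfl
      map_smul' := fun _ _ => rfl }
  -- One scalar equation per edge end: a component of the vertex condition at an inner vertex, the
  -- Dirichlet condition elsewhere.
  let B : (A × Bool → ℂ) × (A × Bool → ℂ) →ₗ[ℂ] (A × Bool → ℂ) := LinearMap.pi fun p =>
    if hv : G.IsInner A (G.endVertex ((p.1 : E), p.2)) then
      ev _ ⟨((p.1 : E), p.2), rfl⟩ ∘ₗ b _ hv ∘ₗ (r _ hv).prodMap (r _ hv)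
    else LinearMap.proj p ∘ₗ LinearMap.fst ℂ _ _
  refine ⟨B, fun F F₁ h => ⟨fun v hv => ?_, fun v hv p hp => ?_⟩⟩
  · refine ⟨r v hv (fun p => F p.1 (G.endCoord ((p.1 : E), p.2))),
      r v hv (fun p => endSign ((p.1 : E), p.2) * F₁ p.1 (G.endCoord ((p.1 : E), p.2))),
      fun p hp => rfl, fun p hp => ?_, hb v hv _ _ (lp.ext (funext ?_))⟩
    · change _ = endSign p.1 * (endSign p.1 * _)
      rw [← mul_assoc, endSign_mul_self, one_mul]
    · rintro ⟨p, rfl⟩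
      have h1 := congrFun h (⟨p.1, hv p rfl⟩, p.2)
      simp only [B, LinearMap.pi_apply] at h1
      rw [dif_pos hv] at h1
      exact h1
  · have h1 := congrFun h (⟨p.1.1, hp⟩, p.1.2)
    have hn : ¬ G.IsInner A (G.endVertex (p.1.1, p.1.2)) := by
      intro hi
      obtain ⟨p', hp', hpA⟩ := hv.2
      exact hpA (hi p' (hp'.trans p.2.symm))
    simp only [B, LinearMap.pi_apply] at h1
    rw [dif_neg hn] at h1
    exact h1

end Boundary

/-! ### Operators on finite subgraphs are self-adjoint -/

section Surjective

variable {E V : Type*} {G : MetricGraph E V} {bc : BoundaryCondition G} {A : Set E}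

theorem IsRep.exists_freeSol [Finite A] {κ : ℝ} (hκ : 0 < κ) (k : G.L2 A) {g : A → ℝ → ℂ}
    (hg : ∀ e : A, ∀ᵐ t ∂(G.edgeMeasure e), (k e : ℝ → ℂ) t = g e t) (c : A → ℂ × ℂ) :
    ∃ f f₁ : G.L2 A, IsRep G f f₁ ((κ ^ 2 : ℂ) • f - k)
      (fun e => freeSol κ (g e) (c e).1 (c e).2) (fun e => freeSolDeriv κ (g e) (c e).1 (c e).2) := by
  choose f f₁ h using fun e : A =>
    exists_isEdgeRep_freeSol (G.len_pos e) hκ (k e) (hg e) (c e).1 (c e).2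
  exact ⟨⟨f, Memℓp.all _⟩, ⟨f₁, Memℓp.all _⟩, h⟩

theorem mem_operatorGraph_zero_of_isRep {ν : E → ℝ → ℝ} {κ : ℝ} {f f₁ k : G.L2 A}
    {F F₁ : A → ℝ → ℂ} (h : IsRep G f f₁ ((κ ^ 2 : ℂ) • f - k) F F₁)
    (hbc : SatisfiesBC bc A F F₁) :
    (f, k + (-(κ ^ 2 : ℝ) : ℂ) • f) ∈ operatorGraph G bc ν (fun _ => 0) A := by
  refine mem_operatorGraph_iff.2 ⟨f₁, _, F, F₁, h, hbc, fun e => ?_⟩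
  filter_upwards [Lp.coeFn_add (k e) ((-(κ ^ 2 : ℝ) : ℂ) • f e),
    Lp.coeFn_smul (-(κ ^ 2 : ℝ) : ℂ) (f e), Lp.coeFn_sub ((κ ^ 2 : ℂ) • f e) (k e),
    Lp.coeFn_smul (κ ^ 2 : ℂ) (f e)] with t e1 e2 e3 e4
  have e1' : ((k + (-(κ ^ 2 : ℝ) : ℂ) • f) e : ℝ → ℂ) t = k e t + (-(κ ^ 2 : ℝ) : ℂ) * f e t := by
    refine Eq.trans e1 ?_
    rw [Pi.add_apply, e2]; rfl
  have e3' : (((κ ^ 2 : ℂ) • f - k) e : ℝ → ℂ) t = (κ ^ 2 : ℂ) * f e t - k e t := by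
    refine Eq.trans e3 ?_
    rw [Pi.sub_apply, e4]; rfl
  rw [e1', e3']
  push_cast
  ring

/-- The boundary values of the solution of the homogeneous equation as a linear function of its
initial values. -/
def homogeneousValues (G : MetricGraph E V) (A : Set E) (κ : ℝ) :
    (A → ℂ × ℂ) →ₗ[ℂ] (A × Bool → ℂ) × (A × Bool → ℂ) where
  toFun c := (fun p => freeSol κ 0 (c p.1).1 (c p.1).2 (G.endCoord ((p.1 : E), p.2)),
    fun p => endSign ((p.1 : E), p.2) *
      freeSolDeriv κ 0 (c p.1).1 (c p.1).2 (G.endCoord ((p.1 : E), p.2)))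
  map_add' c c' := by
    ext p <;> simp [freeSol, freeSolDeriv, expSol] <;> ring
  map_smul' z c := by
    ext p <;> simp [freeSol, freeSolDeriv, expSol] <;> ring

/-- A finite-dimensional Fredholm alternative. The unknowns are the two initial values on each edge,
the equations are indexed by the edge ends, and injectivity holds because `-κ²` lies below the lower
bound of the form. -/
theorem exists_mem_operatorGraph_zero [Finite A] {u U : ℝ} (hG : G.LengthBounds u U)
    {ν : E → ℝ → ℝ} (hν : ∀ e, AEStronglyMeasurable (ν e) (G.edgeMeasure e)) {κ : ℝ} (hκ : 0 < κ)
    (hκS : 2 * bc.S * (1 / u + 2 * bc.S) < κ ^ 2) (k : G.L2 A) :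
    ∃ f, (f, k + (-(κ ^ 2 : ℝ) : ℂ) • f) ∈ operatorGraph G bc ν (fun _ => 0) A := by
  have := Fintype.ofFinite A
  obtain ⟨B, hB⟩ := exists_boundaryMap bc A
  let M := B ∘ₗ homogeneousValues G A κ
  have hinj : Function.Injective M := by
    rw [← LinearMap.ker_eq_bot, LinearMap.ker_eq_bot']
    intro c hc
    obtain ⟨f, f₁, hr⟩ := IsRep.exists_freeSol (G := G) hκ (0 : G.L2 A) (g := fun _ => 0)
      (fun e => Lp.coeFn_zero ℂ 2 (G.edgeMeasure e)) c
    have hbc := hB (fun e => freeSol κ 0 (c e).1 (c e).2)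
      (fun e => freeSolDeriv κ 0 (c e).1 (c e).2) hc
    have hmem := mem_operatorGraph_zero_of_isRep (ν := ν) hr hbc
    have hlow := operatorGraph_re_inner_ge hG hν (Q := 0) (by simp) hmem
    rw [zero_add, zero_add, inner_smul_right, ← Complex.ofReal_neg, Complex.re_ofReal_mul,
      re_inner_self] at hlow
    have hf : f = 0 := by
      by_contra hne
      have : 0 < ‖f‖ ^ 2 := by have := norm_pos_iff.2 hne; positivity
      nlinarith
    funext e
    have hz : ∀ x ∈ Set.Icc 0 (G.len e), freeSol κ 0 (c e).1 (c e).2 x = 0 := fun x hx => by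
      have h0 : ∀ᵐ t ∂(G.edgeMeasure e), (0 : ℂ) = freeSol κ 0 (c e).1 (c e).2 t := by
        filter_upwards [(hr e).eq, Lp.coeFn_zero ℂ 2 (G.edgeMeasure e)] with t h1 h2
        rw [← h1, hf]
        exact h2.symm
      exact (hasBoundaryValue_iff (f := fun _ => 0) (G.len_pos e) h0
        ((hr e).prim.continuousOn (G.len_pos e).le) hx 0).1 tendsto_const_nhds
    have := freeSol_homogeneous_eq_zero (G.len_pos e) hκ
      (hz 0 ⟨le_rfl, (G.len_pos e).le⟩) (hz _ ⟨(G.len_pos e).le, le_rfl⟩)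
    exact Prod.ext this.1 this.2
  have hsurj : Function.Surjective M := by
    -- Both sides have dimension `2 |A|`.
    refine (LinearMap.injective_iff_surjective_of_finrank_eq_finrank ?_).1 hinj
    rw [Module.finrank_pi, Module.finrank_pi_fintype]
    simp [mul_comm]
  -- The initial values are chosen so that the homogeneous solution cancels the boundary defect of
  -- the particular solution with zero initial data.
  obtain ⟨c, hc⟩ := hsurj (-B (fun p => freeSol κ (k p.1) 0 0 (G.endCoord ((p.1 : E), p.2)),
    fun p => endSign ((p.1 : E), p.2) *
      freeSolDeriv κ (k p.1) 0 0 (G.endCoord ((p.1 : E), p.2))))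
  obtain ⟨f, f₁, hr⟩ := IsRep.exists_freeSol (G := G) hκ k (g := fun e => k e)
    (fun e => Eventually.of_forall fun t => rfl) c
  refine ⟨f, mem_operatorGraph_zero_of_isRep hr (hB _ _ ?_)⟩
  rw [← add_eq_zero_iff_eq_neg] at hc
  rw [← hc]
  change _ = B (homogeneousValues G A κ c) + _
  rw [← map_add]
  congr 1
  refine Prod.ext (funext fun p => freeSol_add _ _ _ _ _) (funext fun p => ?_)
  exact (congrArg (endSign _ * ·) (freeSolDeriv_add _ _ _ _ _)).trans (mul_add _ _ _)

/-- The spectrum on a finite subgraph lies above every lower bound of the quadratic form. -/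
theorem notMem_opSpectrum_operatorGraph [Finite A] {u U : ℝ} (hG : G.LengthBounds u U)
    {ν : E → ℝ → ℝ} {q : E → ℝ} {Q : ℝ}
    (hν : ∀ e, AEStronglyMeasurable (ν e) (G.edgeMeasure e)) (hQ0 : 0 ≤ Q)
    (hQ : ∀ e ∈ A, ∀ᵐ t ∂(G.edgeMeasure e), |q e * ν e t| ≤ Q) {m : ℝ}
    (hm : ∀ fg ∈ operatorGraph G bc ν q A, m * ‖fg.1‖ ^ 2 ≤ (⟪fg.1, fg.2⟫_ℂ).re)
    {z : ℂ} (hz : z.re < m) : z ∉ opSpectrum (operatorGraph G bc ν q A) := by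
  set M := 2 * bc.S * (1 / u + 2 * bc.S) with hM
  have hM0 : 0 < M := by have := bc.S_pos; have := hG.1; positivity
  obtain ⟨W, hWn, hW⟩ := exists_mulOperator (A := A) (w := fun e t => q e * ν e t) hQ0
    (fun e => (hν e).const_mul _) hQ
  rw [← coe_operatorSubmodule]
  -- For `κ ≥ M + Q + 1` the free equation is solvable at `-κ`, and the potential, of norm at most
  -- `Q`, is smaller than the distance `κ - M` to the free lower bound `-M`.
  refine notMem_opSpectrum_of_re_lt (κ₀ := M + Q + 1) hm (fun κ hκ k => ?_) hz
  have hκ0 : 0 < κ := by linarith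
  have hsq : Real.sqrt κ ^ 2 = κ := Real.sq_sqrt hκ0.le
  have hs : ∀ k : G.L2 A, ∃ f, (f, k + (-κ : ℂ) • f) ∈
      operatorSubmodule G bc ν (fun _ => 0) A := by
    intro k
    have := exists_mem_operatorGraph_zero (bc := bc) hG hν (Real.sqrt_pos.2 hκ0)
      (by rw [hsq]; linarith) k
    rw [hsq] at this
    simpa only [mem_operatorSubmodule] using this
  have hlow : ∀ fg ∈ operatorSubmodule G bc ν (fun _ => 0) A,
      -M * ‖fg.1‖ ^ 2 ≤ (⟪fg.1, fg.2⟫_ℂ).re := by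
    rintro ⟨f, g⟩ h
    have := operatorGraph_re_inner_ge hG hν (Q := 0) (by simp) (mem_operatorSubmodule.1 h)
    rwa [zero_add] at this
  have hre : (-κ : ℂ).re = -κ := by rw [Complex.neg_re, Complex.ofReal_re]
  obtain ⟨f, hf⟩ := exists_mem_graph_perturbation hlow (by rw [hre]; linarith) hs
    (W := W) (by rw [hre]; linarith) k
  refine ⟨f, ?_⟩
  obtain ⟨f₁, f₂, F, F₁, hr, hbc, hg⟩ := mem_operatorGraph_iff.1 (mem_operatorSubmodule.1 hf)
  refine mem_operatorSubmodule.2 <| mem_operatorGraph_iff.2 ⟨f₁, f₂, F, F₁, hr, hbc, fun e => ?_⟩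
  filter_upwards [hg e, hW f e, Lp.coeFn_sub ((k + (-κ : ℂ) • f) e) (W f e)] with t h1 h2 h3
  have h3' : ((k + (-κ : ℂ) • f - W f) e : ℝ → ℂ) t = (k + (-κ : ℂ) • f) e t - W f e t := h3
  have h4 : ((k + (-κ : ℂ) • f) e : ℝ → ℂ) t - W f e t = -f₂ e t + ((0 * ν e t : ℝ) : ℂ) * f e t :=
    h3'.symm.trans h1
  rw [h2, zero_mul, Complex.ofReal_zero, zero_mul, add_zero, sub_eq_iff_eq_add] at h4
  exact h4

end Surjective

/-! ### Functions with prescribed derivatives at the ends of an edge and small norm -/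

section Cutoff

/-- A `C²` function on `[0, ∞)` with value `0` and derivative `1` at `0`, vanishing on
`[ε, ∞)`. -/
def cut (ε t : ℝ) : ℝ := t * max 0 (1 - t / ε) ^ 3

/-- The derivative of `cut`. -/
def cutDeriv (ε t : ℝ) : ℝ := max 0 (1 - t / ε) ^ 3 - 3 * (t / ε) * max 0 (1 - t / ε) ^ 2

/-- The second derivative of `cut`. -/
def cutDeriv2 (ε t : ℝ) : ℝ :=
  -(6 / ε) * max 0 (1 - t / ε) ^ 2 + 6 / ε * (t / ε) * max 0 (1 - t / ε)

/-- The exponent is at least `2`, so near the kink at `0` the function is bounded by `x²` and its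
derivative vanishes there. -/
theorem hasDerivAt_max_pow (n : ℕ) (x : ℝ) :
    HasDerivAt (fun x : ℝ => max 0 x ^ (n + 2)) ((n + 2) * max 0 x ^ (n + 1)) x := by
  rcases lt_trichotomy x 0 with h | h | h
  · have e : (fun x : ℝ => max 0 x ^ (n + 2)) =ᶠ[𝓝 x] fun _ => 0 := by
      filter_upwards [gt_mem_nhds h] with y hy
      rw [max_eq_left hy.le]; simp
    rw [max_eq_left h.le]
    simpa using (hasDerivAt_const x (0 : ℝ)).congr_of_eventuallyEq e
  · subst h
    rw [max_self, zero_pow (by omega), mul_zero, hasDerivAt_iff_isLittleO]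
    have : (fun y : ℝ => y ^ 2) =o[𝓝 0] fun y : ℝ => y := by
      simpa using (Asymptotics.isLittleO_pow_id (𝕜 := ℝ) (n := 2) (by norm_num))
    refine (Asymptotics.IsBigO.of_bound 1 ?_).trans_isLittleO
      (by simpa using this : (fun y : ℝ => y ^ 2) =o[𝓝 0] fun y : ℝ => y - 0)
    filter_upwards [Metric.ball_mem_nhds (0 : ℝ) one_pos] with y hy
    rw [Metric.mem_ball, dist_zero_right, Real.norm_eq_abs] at hy
    have h0 : |max 0 y| ≤ |y| := by
      rcases le_total 0 y with h | h
      · rw [max_eq_right h]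
      · rw [max_eq_left h]; simp
    simp only [max_self, smul_zero, sub_zero, one_mul, norm_pow, Real.norm_eq_abs]
    rw [zero_pow (by omega), sub_zero, abs_pow]
    calc |max 0 y| ^ (n + 2) ≤ |y| ^ (n + 2) := by gcongr
      _ = |y| ^ n * |y| ^ 2 := pow_add _ _ _
      _ ≤ 1 * |y| ^ 2 := by gcongr; exact pow_le_one₀ (abs_nonneg _) hy.le
      _ = |y| ^ 2 := one_mul _
  · have e : (fun x : ℝ => max 0 x ^ (n + 2)) =ᶠ[𝓝 x] fun y => y ^ (n + 2) := by
      filter_upwards [lt_mem_nhds h] with y hy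
      rw [max_eq_right hy.le]
    rw [max_eq_right h.le]
    simpa using (hasDerivAt_pow (n + 2) x).congr_of_eventuallyEq e

theorem hasDerivAt_one_sub_div (ε t : ℝ) : HasDerivAt (fun t : ℝ => 1 - t / ε) (-(1 / ε)) t := by
  simpa using ((hasDerivAt_id t).div_const ε).const_sub 1

theorem hasDerivAt_cut (ε t : ℝ) : HasDerivAt (cut ε) (cutDeriv ε t) t := by
  have h := (hasDerivAt_id t).mul
    (HasDerivAt.comp t (hasDerivAt_max_pow 1 (1 - t / ε)) (hasDerivAt_one_sub_div ε t))
  refine h.congr_deriv ?_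
  simp only [cutDeriv, Function.comp, id]
  push_cast
  ring

theorem hasDerivAt_cutDeriv (ε t : ℝ) : HasDerivAt (cutDeriv ε) (cutDeriv2 ε t) t := by
  have h3 := HasDerivAt.comp t (hasDerivAt_max_pow 1 (1 - t / ε)) (hasDerivAt_one_sub_div ε t)
  have h2 := HasDerivAt.comp t (hasDerivAt_max_pow 0 (1 - t / ε)) (hasDerivAt_one_sub_div ε t)
  have h := h3.sub ((((hasDerivAt_id t).div_const ε).const_mul 3).mul h2)
  refine h.congr_deriv ?_
  simp only [cutDeriv2, Function.comp, id]
  push_cast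
  ring

theorem continuous_cutDeriv2 (ε : ℝ) : Continuous (cutDeriv2 ε) := by
  unfold cutDeriv2; fun_prop

theorem max_one_sub_div_eq_zero {ε t : ℝ} (hε : 0 < ε) (h : ε ≤ t) : max 0 (1 - t / ε) = 0 :=
  max_eq_left (by have := (one_le_div hε).2 h; linarith)

theorem max_one_sub_div_le {ε t : ℝ} (hε : 0 < ε) (h : 0 ≤ t) :
    0 ≤ max 0 (1 - t / ε) ∧ max 0 (1 - t / ε) ≤ 1 :=
  ⟨le_max_left _ _, max_le zero_le_one (by have : 0 ≤ t / ε := by positivity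
                                           linarith)⟩

theorem cut_eq_zero {ε t : ℝ} (hε : 0 < ε) (h : ε ≤ t) :
    cut ε t = 0 ∧ cutDeriv ε t = 0 ∧ cutDeriv2 ε t = 0 := by
  simp [cut, cutDeriv, cutDeriv2, max_one_sub_div_eq_zero hε h]

theorem cut_zero (ε : ℝ) : cut ε 0 = 0 ∧ cutDeriv ε 0 = 1 := by simp [cut, cutDeriv]

theorem abs_cut_le {ε t : ℝ} (hε : 0 < ε) (h : 0 ≤ t) : |cut ε t| ≤ ε := by
  rcases le_total ε t with h' | h'
  · rw [(cut_eq_zero hε h').1, abs_zero]; exact hε.le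
  · obtain ⟨h1, h2⟩ := max_one_sub_div_le hε h
    rw [cut, abs_of_nonneg (by positivity)]
    calc t * max 0 (1 - t / ε) ^ 3 ≤ ε * 1 := by gcongr; exact pow_le_one₀ h1 h2
      _ = ε := mul_one _

theorem abs_cutDeriv2_le {ε t : ℝ} (hε : 0 < ε) (h : 0 ≤ t) : |cutDeriv2 ε t| ≤ 12 / ε := by
  rcases le_total ε t with h' | h'
  · rw [(cut_eq_zero hε h').2.2, abs_zero]; positivity
  · obtain ⟨h1, h2⟩ := max_one_sub_div_le hε h
    have h3 : t / ε ≤ 1 := (div_le_one hε).2 h'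
    have h4 : 0 ≤ t / ε := by positivity
    have h5 : 0 < 6 / ε := by positivity
    unfold cutDeriv2
    set m := max 0 (1 - t / ε)
    have a1 : 6 / ε * m ^ 2 ≤ 6 / ε := mul_le_of_le_one_right h5.le (pow_le_one₀ h1 h2)
    have a2 : 6 / ε * (t / ε) * m ≤ 6 / ε := by
      rw [mul_assoc]; exact mul_le_of_le_one_right h5.le (mul_le_one₀ h3 h1 h2)
    have a3 : 0 ≤ 6 / ε * m ^ 2 := by positivity
    have a4 : 0 ≤ 6 / ε * (t / ε) * m := by positivity
    have a5 : 12 / ε = 6 / ε + 6 / ε := by ring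
    rw [abs_le]
    constructor <;> linarith

variable {l : ℝ}

/-- The integrand lives on two end strips of total length at most `2 * ε`. -/
theorem norm_integral_le_of_support {w : ℝ → ℂ} {D ε : ℝ} (hD : 0 ≤ D) (hε : 0 < ε)
    (h1 : ∀ t ∈ Set.Ioo 0 l, ‖w t‖ ≤ D)
    (h2 : ∀ t ∈ Set.Ioo 0 l, ε ≤ t → ε ≤ l - t → w t = 0) :
    ‖∫ t in Set.Ioo 0 l, w t‖ ≤ D * (2 * ε) := by
  set S : Set ℝ := Set.Ioo 0 l ∩ (Set.Ioo 0 ε ∪ Set.Ioo (l - ε) l) with hS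
  have e : ∫ t in Set.Ioo 0 l, w t = ∫ t in S, w t := by
    refine setIntegral_eq_of_subset_of_forall_sdiff_eq_zero measurableSet_Ioo
      Set.inter_subset_left fun t ht => h2 t ht.1 ?_ ?_
    · by_contra hlt
      exact ht.2 ⟨ht.1, Or.inl ⟨ht.1.1, not_le.1 hlt⟩⟩
    · by_contra hlt
      exact ht.2 ⟨ht.1, Or.inr ⟨by linarith [not_le.1 hlt], ht.1.2⟩⟩
  have hv : volume (Set.Ioo 0 ε ∪ Set.Ioo (l - ε) l) ≤ ENNReal.ofReal (2 * ε) := by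
    refine (measure_union_le _ _).trans ?_
    rw [Real.volume_Ioo, Real.volume_Ioo, ← ENNReal.ofReal_add (by linarith) (by linarith)]
    exact ENNReal.ofReal_le_ofReal (by linarith)
  have hvS : volume S ≤ ENNReal.ofReal (2 * ε) :=
    (measure_mono Set.inter_subset_right).trans hv
  rw [e]
  refine (norm_setIntegral_le_of_norm_le_const (hvS.trans_lt ENNReal.ofReal_lt_top)
    fun t ht => h1 t ht.1).trans ?_
  gcongr
  exact ENNReal.toReal_le_of_le_ofReal (by positivity) hvS

theorem IsPrim.norm_sub_le {F F₁ : ℝ → ℂ} (h : IsPrim l F F₁) {B : ℝ}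
    (hB : ∀ t ∈ Set.Icc 0 l, ‖F₁ t‖ ≤ B) {s t : ℝ} (hs : s ∈ Set.Icc 0 l)
    (ht : t ∈ Set.Icc 0 l) : ‖F t - F s‖ ≤ B * |t - s| := by
  have h0 : (0 : ℝ) ∈ Set.Icc 0 l := ⟨le_rfl, ht.1.trans ht.2⟩
  have e : F t - F s = ∫ r in s..t, F₁ r := by
    rw [h.2 t ht, h.2 s hs, ← intervalIntegral.integral_interval_sub_left
      (h.intervalIntegrable h0 ht) (h.intervalIntegrable h0 hs)]
    ring
  rw [e]
  refine intervalIntegral.norm_integral_le_of_norm_le_const fun r hr => hB r ?_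
  exact Set.uIcc_subset_Icc hs ht (Set.uIoc_subset_uIcc hr)

/-- Functions `Θ` on an edge that vanish at its ends, have prescribed derivatives there, and are
small in the sense of quadratic forms, if the prescribed derivatives vanish at those ends at which
`F` does not. -/
theorem IsEdgeRep.exists_cutoff (hl : 0 < l) {f f₁ f₂ : Lp ℂ 2 (volume.restrict (Set.Ioo 0 l))}
    {F F₁ : ℝ → ℂ} (h : IsEdgeRep l f f₁ f₂ F F₁) {c₀ c₁ : ℂ} (h0 : c₀ ≠ 0 → F 0 = 0)
    (h1 : c₁ ≠ 0 → F l = 0) :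
    ∃ K : ℝ, 0 ≤ K ∧ ∀ ε : ℝ, 0 < ε → ε < l →
      ∃ (θ θ₁ θ₂ : Lp ℂ 2 (volume.restrict (Set.Ioo 0 l))) (Θ Θ₁ : ℝ → ℂ),
        IsEdgeRep l θ θ₁ θ₂ Θ Θ₁ ∧ Θ 0 = 0 ∧ Θ l = 0 ∧ Θ₁ 0 = c₀ ∧ Θ₁ l = c₁ ∧
        ‖θ‖ ≤ K * ε ∧ ‖⟪f - θ, θ₂⟫_ℂ‖ ≤ K * ε := by
  obtain ⟨B, hB⟩ := isCompact_Icc.exists_bound_of_continuousOn (h.prim₁.continuousOn hl.le)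
  have hB0 : 0 ≤ B := (norm_nonneg _).trans (hB 0 ⟨le_rfl, hl.le⟩)
  set C := ‖c₀‖ + ‖c₁‖ with hC
  have hC0 : 0 ≤ C := by positivity
  -- The first summand serves the norm of `θ`; the second is the integrand bound `12 * C * (B + C)`
  -- times the strip length `2 * ε`.
  refine ⟨C * (l + 1) + 12 * C * (B + C) * 2, by positivity, fun ε hε hεl => ?_⟩
  let Θ : ℝ → ℂ := fun t => c₀ * (cut ε t : ℂ) + -c₁ * (cut ε (l - t) : ℂ)
  let Θ₁ : ℝ → ℂ := fun t => c₀ * (cutDeriv ε t : ℂ) + -c₁ * -(cutDeriv ε (l - t) : ℂ)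
  let Θ₂ : ℝ → ℂ := fun t => c₀ * (cutDeriv2 ε t : ℂ) + -c₁ * (cutDeriv2 ε (l - t) : ℂ)
  have hrefl : ∀ t : ℝ, HasDerivAt (fun t : ℝ => l - t) (-1) t := fun t => by
    simpa using (hasDerivAt_id t).const_sub l
  have d1 : ∀ t, HasDerivAt Θ (Θ₁ t) t := fun t => by
    have a := (hasDerivAt_cut ε t).ofReal_comp.const_mul c₀
    have b := ((hasDerivAt_cut ε (l - t)).comp t (hrefl t)).ofReal_comp.const_mul (-c₁)
    refine (a.add b).congr_deriv ?_
    simp only [Θ₁]; push_cast; ring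
  have d2 : ∀ t, HasDerivAt Θ₁ (Θ₂ t) t := fun t => by
    have a := (hasDerivAt_cutDeriv ε t).ofReal_comp.const_mul c₀
    have b := ((hasDerivAt_cutDeriv ε (l - t)).comp t (hrefl t)).ofReal_comp.neg.const_mul (-c₁)
    refine (a.add b).congr_deriv ?_
    simp only [Θ₂]; push_cast; ring
  have c2 : Continuous Θ₂ := by
    have := continuous_cutDeriv2 ε
    simp only [Θ₂]
    fun_prop
  have c1 : Continuous Θ₁ := continuous_iff_continuousAt.2 fun t => (d2 t).continuousAt
  have c0 : Continuous Θ := continuous_iff_continuousAt.2 fun t => (d1 t).continuousAt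
  have m0 := memLp_of_continuousOn (l := l) c0.continuousOn
  have m1 := memLp_of_continuousOn (l := l) c1.continuousOn
  have m2 := memLp_of_continuousOn (l := l) c2.continuousOn
  have z := cut_eq_zero hε hεl.le
  have hΘ : ∀ t ∈ Set.Ioo 0 l, ‖Θ t‖ ≤ C * ε := by
    intro t ht
    refine (norm_add_le _ _).trans ?_
    rw [norm_mul, norm_mul, norm_neg, Complex.norm_real, Complex.norm_real, Real.norm_eq_abs,
      Real.norm_eq_abs, hC, add_mul]
    gcongr
    · exact abs_cut_le hε ht.1.le
    · exact abs_cut_le hε (by linarith [ht.2])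
  refine ⟨m0.toLp _, m1.toLp _, m2.toLp _, Θ, Θ₁,
    ⟨isPrim_of_hasDerivAt (fun t _ => d1 t) c1.continuousOn,
      (isPrim_of_hasDerivAt (fun t _ => d2 t) c2.continuousOn).congr_deriv
        (m2.coeFn_toLp.mono fun t ht => ht.symm), m0.coeFn_toLp, m1.coeFn_toLp⟩, ?_, ?_, ?_, ?_,
      ?_, ?_⟩
  · simp [Θ, z, cut_zero]
  · simp [Θ, z, cut_zero]
  · simp [Θ₁, z, cut_zero]
  · simp [Θ₁, z, cut_zero]
  · have hn : ‖m0.toLp _‖ ^ 2 = ∫ t in Set.Ioo 0 l, ‖Θ t‖ ^ 2 := normSq_eq_of_ae_eq m0.coeFn_toLp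
    have hle : ∫ t in Set.Ioo 0 l, ‖Θ t‖ ^ 2 ≤ (C * ε) ^ 2 * l := by
      have : ∫ t in Set.Ioo 0 l, (C * ε) ^ 2 = (C * ε) ^ 2 * l := by
        simp [hl.le]; ring
      rw [← this]
      refine setIntegral_mono_on (integrable_normSq_of_continuousOn c0.continuousOn)
        (integrableOn_const (by simp) (by finiteness)) measurableSet_Ioo fun t ht => ?_
      gcongr
      exact hΘ t ht
    have h2 : ‖m0.toLp _‖ ≤ C * (l + 1) * ε := by
      refine le_of_sq_le_sq ?_ (by positivity)
      rw [hn]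
      refine hle.trans ?_
      have : (C * (l + 1) * ε) ^ 2 = (C * ε) ^ 2 * (l + 1) ^ 2 := by ring
      rw [this]
      gcongr
      nlinarith
    refine h2.trans ?_
    gcongr
    have : 0 ≤ 12 * C * (B + C) * 2 := by positivity
    linarith
  -- On a strip where the correction is active, its second derivative is of order `1 / ε`, while `F
  -- - Θ` is of order `ε` because `F` vanishes at that end. The product is bounded uniformly in `ε`.
  · have hD : ∀ t ∈ Set.Ioo 0 l, ∀ c : ℂ, ∀ s : ℝ, 0 ≤ s → (c ≠ 0 → s < ε → ‖F t‖ ≤ B * ε) →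
        ‖c * (cutDeriv2 ε s : ℂ)‖ * ‖F t - Θ t‖ ≤ ‖c‖ * (12 * (B + C)) := by
      intro t ht c s hs hF
      rcases eq_or_ne c 0 with rfl | hc
      · simp
      rcases le_or_gt ε s with hse | hse
      · rw [(cut_eq_zero hε hse).2.2]; simp; positivity
      · have hG : ‖F t - Θ t‖ ≤ (B + C) * ε :=
          (norm_sub_le _ _).trans (by have := hF hc hse; have := hΘ t ht; linarith)
        rw [norm_mul, Complex.norm_real, Real.norm_eq_abs, mul_assoc]
        refine mul_le_mul_of_nonneg_left ?_ (norm_nonneg c)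
        calc |cutDeriv2 ε s| * ‖F t - Θ t‖ ≤ 12 / ε * ((B + C) * ε) := by
              gcongr
              exact abs_cutDeriv2_le hε hs
          _ = 12 * (B + C) := by field_simp
    have e : ⟪f - m0.toLp _, m2.toLp _⟫_ℂ =
        ∫ t in Set.Ioo 0 l, Θ₂ t * starRingEnd ℂ (F t - Θ t) := by
      rw [L2.inner_def]
      refine integral_congr_ae ?_
      filter_upwards [Lp.coeFn_sub f (m0.toLp _), m0.coeFn_toLp, m2.coeFn_toLp, h.eq]
        with t e1 e2 e3 e4
      rw [e1, e3, Pi.sub_apply, e2, e4, RCLike.inner_apply]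
    rw [e]
    have hint := norm_integral_le_of_support (l := l) (D := 12 * C * (B + C)) (ε := ε)
      (w := fun t => Θ₂ t * starRingEnd ℂ (F t - Θ t)) (by positivity) hε ?_ ?_
    · refine hint.trans ?_
      have : 0 ≤ C * (l + 1) * ε := by positivity
      linarith
    · intro t ht
      have htI : t ∈ Set.Icc 0 l := ⟨ht.1.le, ht.2.le⟩
      have a := hD t ht c₀ t ht.1.le fun hc hlt => by
        have := h.prim.norm_sub_le hB ⟨le_rfl, hl.le⟩ htI
        rw [h0 hc, sub_zero, sub_zero, abs_of_pos ht.1] at this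
        exact this.trans (by gcongr)
      have b := hD t ht (-c₁) (l - t) (by linarith [ht.2]) fun hc hlt => by
        have := h.prim.norm_sub_le hB ⟨hl.le, le_rfl⟩ htI
        rw [h1 (neg_ne_zero.1 hc), sub_zero, abs_sub_comm, abs_of_pos (by linarith [ht.2])] at this
        exact this.trans (by gcongr)
      rw [norm_mul, RCLike.norm_conj]
      calc ‖Θ₂ t‖ * ‖F t - Θ t‖ ≤ (‖c₀ * (cutDeriv2 ε t : ℂ)‖ + ‖-c₁ * (cutDeriv2 ε (l - t) : ℂ)‖) *
            ‖F t - Θ t‖ := by gcongr; exact norm_add_le _ _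
        _ ≤ ‖c₀‖ * (12 * (B + C)) + ‖-c₁‖ * (12 * (B + C)) := by rw [add_mul]; exact add_le_add a b
        _ = 12 * C * (B + C) := by rw [norm_neg, hC]; ring
    · intro t _ h1 h2
      simp [Θ₂, (cut_eq_zero hε h1).2.2, (cut_eq_zero hε h2).2.2]

end Cutoff

/-! ### Comparison with the ground state energy -/

section Extend

variable {E V : Type*} {G : MetricGraph E V} {bc : BoundaryCondition G} {A : Set E}

open Classical in
/-- Extension by zero of a function on a finite subgraph. -/
def extendL2 (G : MetricGraph E V) (A : Set E) [Finite A] (f : G.L2 A) :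
    G.L2 (Set.univ : Set E) :=
  ⟨fun e => if h : e.1 ∈ A then f ⟨e.1, h⟩ else 0, by
    refine (memℓp_zero (Set.Finite.subset
      ((Set.toFinite A).preimage Subtype.val_injective.injOn) ?_)).of_exponent_ge zero_le
    intro e he
    by_contra hA
    exact he (dif_neg hA)⟩

theorem extendL2_apply_mem [Finite A] (f : G.L2 A) (e : (Set.univ : Set E)) (h : e.1 ∈ A) :
    extendL2 G A f e = f ⟨e.1, h⟩ := dif_pos h

theorem extendL2_apply_notMem [Finite A] (f : G.L2 A) (e : (Set.univ : Set E)) (h : e.1 ∉ A) :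
    extendL2 G A f e = 0 := dif_neg h

theorem inner_extendL2 [Finite A] (f g : G.L2 A) :
    ⟪extendL2 G A f, extendL2 G A g⟫_ℂ = ⟪f, g⟫_ℂ := by
  have h1 := lp.hasSum_inner (𝕜 := ℂ) (extendL2 G A f) (extendL2 G A g)
  have h2 := lp.hasSum_inner (𝕜 := ℂ) f g
  let i : A → (Set.univ : Set E) := fun e => ⟨e, trivial⟩
  have hi : Function.Injective i := fun x y h => Subtype.ext (congrArg (fun z => z.1) h)
  rw [← hi.hasSum_iff] at h1
  · refine h1.unique (h2.congr_fun fun e => ?_)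
    rw [Function.comp, extendL2_apply_mem f (i e) e.2, extendL2_apply_mem g (i e) e.2]
  · intro e he
    have : e.1 ∉ A := fun h => he ⟨⟨e.1, h⟩, rfl⟩
    rw [extendL2_apply_notMem f e this, inner_zero_left]

/-- A function in the domain on a finite subgraph whose boundary values and derivatives vanish
at the vertices that are not inner extends by zero to the whole graph. -/
theorem extendL2_mem_operatorGraph [Finite A] {ν : E → ℝ → ℝ} {q : E → ℝ} {g k g₁ g₂ : G.L2 A}
    {K K₁ : A → ℝ → ℂ} (h : IsRep G g g₁ g₂ K K₁) (hbc : SatisfiesBC bc A K K₁)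
    (hz : ∀ p : A × Bool, ¬ G.IsInner A (G.endVertex ((p.1 : E), p.2)) →
      K p.1 (G.endCoord ((p.1 : E), p.2)) = 0 ∧ K₁ p.1 (G.endCoord ((p.1 : E), p.2)) = 0)
    (hk : ∀ e : A, ∀ᵐ t ∂(G.edgeMeasure e),
      (k e : ℝ → ℂ) t = -(g₂ e : ℝ → ℂ) t + ((q e * ν e t : ℝ) : ℂ) * (g e : ℝ → ℂ) t) :
    (extendL2 G A g, extendL2 G A k) ∈ operatorGraph G bc ν q Set.univ := by
  classical
  let X : (A → ℝ → ℂ) → ↥(Set.univ : Set E) → ℝ → ℂ := fun K e =>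
    if h : e.1 ∈ A then K ⟨e.1, h⟩ else fun _ => 0
  have Xp : ∀ (K : A → ℝ → ℂ) (e : (Set.univ : Set E)) (h : e.1 ∈ A), X K e = K ⟨e.1, h⟩ :=
    fun K e h => dif_pos h
  have Xn : ∀ (K : A → ℝ → ℂ) (e : (Set.univ : Set E)) (_ : e.1 ∉ A), X K e = fun _ => 0 :=
    fun K e h => dif_neg h
  refine mem_operatorGraph_iff.2 ⟨extendL2 G A g₁, extendL2 G A g₂, X K, X K₁, fun e => ?_,
    ⟨fun v _ => ?_, fun v hv => ?_⟩, fun e => ?_⟩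
  · by_cases he : e.1 ∈ A
    · rw [extendL2_apply_mem _ _ he, extendL2_apply_mem _ _ he, extendL2_apply_mem _ _ he,
        Xp _ _ he, Xp _ _ he]
      exact h ⟨e.1, he⟩
    · rw [extendL2_apply_notMem _ _ he, extendL2_apply_notMem _ _ he,
        extendL2_apply_notMem _ _ he, Xn _ _ he, Xn _ _ he]
      have h0 : ((0 : Lp ℂ 2 (G.edgeMeasure e)) : ℝ → ℂ) =ᵐ[G.edgeMeasure e] 0 :=
        Lp.coeFn_zero ℂ 2 (G.edgeMeasure e)
      exact ⟨isPrim_const 0, (isPrim_const 0).congr_deriv (h0.mono fun t ht => ht.symm), h0, h0⟩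
  · by_cases hv : G.IsInner A v
    · obtain ⟨x, y, hx, hy, hb⟩ := hbc.1 v hv
      refine ⟨x, y, fun p hp => ?_, fun p hp => ?_, hb⟩
      · rw [Xp _ _ (hv p.1 p.2)]; exact hx p _
      · rw [Xp _ _ (hv p.1 p.2)]; exact hy p _
    -- At a vertex that is not inner for `A`, all boundary values and derivatives of the extension
    -- are zero, and the pair `(0, 0)` satisfies every boundary condition.
    · refine ⟨0, 0, fun p hp => ?_, fun p hp => ?_, bc.holds_zero v⟩
      · by_cases he : p.1.1 ∈ A
        · rw [Xp _ _ he]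
          exact (hz (⟨p.1.1, he⟩, p.1.2) (by rw [show G.endVertex (p.1.1, p.1.2) = v from p.2]
                                             exact hv)).1
        · rw [Xn _ _ he]; rfl
      · by_cases he : p.1.1 ∈ A
        · rw [Xp _ _ he]
          exact ((hz (⟨p.1.1, he⟩, p.1.2) (by rw [show G.endVertex (p.1.1, p.1.2) = v from p.2]
                                              exact hv)).2).trans (mul_zero _).symm
        · rw [Xn _ _ he]; exact (mul_zero _).symm
  · obtain ⟨p, _, hp⟩ := hv.2
    exact absurd trivial hp
  · by_cases he : e.1 ∈ A
    · rw [extendL2_apply_mem _ _ he, extendL2_apply_mem _ _ he, extendL2_apply_mem _ _ he]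
      exact hk ⟨e.1, he⟩
    · rw [extendL2_apply_notMem _ _ he, extendL2_apply_notMem _ _ he,
        extendL2_apply_notMem _ _ he]
      filter_upwards [Lp.coeFn_zero ℂ 2 (G.edgeMeasure e)] with t ht
      rw [ht]; simp

/-- Normalise `f`. The a priori bound `m` makes the set in the infimum bounded below, without which
`sInf` would carry no information. -/
theorem lowerBound_mul_le {H : Type*} [NormedAddCommGroup H] [InnerProductSpace ℂ H]
    {T : Submodule ℂ (H × H)} {m : ℝ}
    (hm : ∀ fg ∈ T, m * ‖fg.1‖ ^ 2 ≤ (⟪fg.1, fg.2⟫_ℂ).re) {f g : H} (h : (f, g) ∈ T) :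
    lowerBound (T : Set (H × H)) * ‖f‖ ^ 2 ≤ (⟪f, g⟫_ℂ).re := by
  rcases eq_or_ne f 0 with rfl | hf
  · simp
  have hn : 0 < ‖f‖ := norm_pos_iff.2 hf
  set c : ℂ := ((‖f‖⁻¹ : ℝ) : ℂ) with hc
  have hbd : BddBelow {c | ∃ f g, (f, g) ∈ (T : Set (H × H)) ∧ ‖f‖ = 1 ∧ c = (⟪f, g⟫_ℂ).re} := by
    refine ⟨m, ?_⟩
    rintro _ ⟨f, g, hT, h1, rfl⟩
    simpa [h1] using hm _ hT
  have hle : lowerBound (T : Set (H × H)) ≤ (⟪c • f, c • g⟫_ℂ).re := by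
    refine csInf_le hbd ⟨c • f, c • g, T.smul_mem c h, ?_, rfl⟩
    rw [norm_smul, hc, Complex.norm_real, Real.norm_eq_abs, abs_of_pos (inv_pos.2 hn),
      inv_mul_cancel₀ hn.ne']
  rw [inner_smul_left, inner_smul_right, hc, Complex.conj_ofReal, Complex.re_ofReal_mul,
    Complex.re_ofReal_mul] at hle
  calc _ ≤ ‖f‖⁻¹ * (‖f‖⁻¹ * (⟪f, g⟫_ℂ).re) * ‖f‖ ^ 2 := by gcongr
    _ = _ := by field_simp

theorem ae_abs_mul_le {ν : E → ℝ → ℝ} {cm cp : ℝ} (hν : IsSingleSite G ν cm cp) {a Q : ℝ}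
    (ha : |a| ≤ Q) (e : E) : ∀ᵐ t ∂(G.edgeMeasure e), |a * ν e t| ≤ Q * cp := by
  filter_upwards [(hν.2.2 e).2] with t ht
  have h0 : 0 < ν e t := hν.1.trans_le ht.1
  rw [abs_mul, abs_of_pos h0]
  exact mul_le_mul ha ht.2 h0.le ((abs_nonneg a).trans ha)

theorem groundEnergy_mul_le {u U : ℝ} (hG : G.LengthBounds u U) {ν : E → ℝ → ℝ} {cm cp : ℝ}
    (hν : IsSingleSite G ν cm cp) {qm : ℝ} {f g : G.L2 (Set.univ : Set E)}
    (h : (f, g) ∈ operatorGraph G bc ν (fun _ => qm) Set.univ) :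
    groundEnergy G bc ν qm * ‖f‖ ^ 2 ≤ (⟪f, g⟫_ℂ).re := by
  unfold groundEnergy
  rw [← coe_operatorSubmodule]
  refine lowerBound_mul_le (m := -(|qm| * cp + 2 * bc.S * (1 / u + 2 * bc.S))) (fun fg hfg => ?_) (mem_operatorSubmodule.2 h)
  exact operatorGraph_re_inner_ge hG (fun e => (hν.2.2 e).1)
    (fun e _ => ae_abs_mul_le hν le_rfl e) (mem_operatorSubmodule.1 hfg)

/-- Derivatives at ends over non-inner vertices do not enter the boundary conditions, so they may be
changed freely. -/
theorem SatisfiesBC.congr {F F₁ K K₁ : A → ℝ → ℂ} (h : SatisfiesBC bc A F F₁)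
    (h0 : ∀ p : A × Bool,
      K p.1 (G.endCoord ((p.1 : E), p.2)) = F p.1 (G.endCoord ((p.1 : E), p.2)))
    (h1 : ∀ p : A × Bool, G.IsInner A (G.endVertex ((p.1 : E), p.2)) →
      K₁ p.1 (G.endCoord ((p.1 : E), p.2)) = F₁ p.1 (G.endCoord ((p.1 : E), p.2))) :
    SatisfiesBC bc A K K₁ := by
  refine ⟨fun v hv => ?_, fun v hv p hp => (h0 (⟨p.1.1, hp⟩, p.1.2)).trans (h.2 v hv p hp)⟩
  obtain ⟨x, y, hx, hy, hb⟩ := h.1 v hv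
  refine ⟨x, y, fun p hp => (h0 (⟨p.1.1, hp⟩, p.1.2)).trans (hx p hp), fun p hp => ?_, hb⟩
  refine (h1 (⟨p.1.1, hp⟩, p.1.2) ?_).trans (hy p hp)
  rw [show G.endVertex (p.1.1, p.1.2) = v from p.2]
  exact hv

theorem IsEdgeRep.sub {l : ℝ} {f f₁ f₂ g g₁ g₂ : Lp ℂ 2 (volume.restrict (Set.Ioo 0 l))}
    {F F₁ K K₁ : ℝ → ℂ} (h : IsEdgeRep l f f₁ f₂ F F₁) (h' : IsEdgeRep l g g₁ g₂ K K₁) :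
    IsEdgeRep l (f - g : Lp ℂ 2 (volume.restrict (Set.Ioo 0 l)))
      (f₁ - g₁ : Lp ℂ 2 (volume.restrict (Set.Ioo 0 l)))
      (f₂ - g₂ : Lp ℂ 2 (volume.restrict (Set.Ioo 0 l)))
      (fun t => F t - K t) (fun t => F₁ t - K₁ t) where
  prim := h.prim.sub h'.prim
  prim₁ := (h.prim₁.sub h'.prim₁).congr_deriv (by
    filter_upwards [Lp.coeFn_sub f₂ g₂] with t ht; rw [ht]; rfl)
  eq := by
    filter_upwards [Lp.coeFn_sub f g, h.eq, h'.eq] with t h1 h2 h3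
    rw [h1, Pi.sub_apply, h2, h3]
  eq₁ := by
    filter_upwards [Lp.coeFn_sub f₁ g₁, h.eq₁, h'.eq₁] with t h1 h2 h3
    rw [h1, Pi.sub_apply, h2, h3]

theorem norm_sq_eq_sum {ι : Type*} [Fintype ι] {B : ι → Type*} [∀ i, NormedAddCommGroup (B i)]
    [∀ i, InnerProductSpace ℂ (B i)] (f : lp B 2) : ‖f‖ ^ 2 = ∑ i, ‖f i‖ ^ 2 := by
  have := lp.norm_rpow_eq_tsum (p := 2) (by norm_num) f
  rw [tsum_fintype] at this
  simpa using this

/-- Approximation of a function in the domain on a finite subgraph by functions that vanish with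
their derivatives at the boundary vertices. -/
theorem IsRep.exists_approximation [Finite A] {u U : ℝ} (hG : G.LengthBounds u U)
    {f f₁ f₂ : G.L2 A} {F F₁ : A → ℝ → ℂ} (h : IsRep G f f₁ f₂ F F₁)
    (hbc : SatisfiesBC bc A F F₁) :
    ∃ K : ℝ, ∀ ε : ℝ, 0 < ε → ε < u → ∃ (θ θ₁ θ₂ : G.L2 A) (Θ Θ₁ : A → ℝ → ℂ),
      IsRep G (f - θ) (f₁ - θ₁) (f₂ - θ₂) Θ Θ₁ ∧ SatisfiesBC bc A Θ Θ₁ ∧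
      (∀ p : A × Bool, ¬ G.IsInner A (G.endVertex ((p.1 : E), p.2)) →
        Θ p.1 (G.endCoord ((p.1 : E), p.2)) = 0 ∧ Θ₁ p.1 (G.endCoord ((p.1 : E), p.2)) = 0) ∧
      ‖θ‖ ≤ K * ε ∧ ‖⟪f - θ, θ₂⟫_ℂ‖ ≤ K * ε := by
  classical
  have := Fintype.ofFinite A
  -- Only derivatives at non-inner vertices are removed; the correction has zero value and zero
  -- derivative at inner ones, so their boundary conditions persist.
  let c : A × Bool → ℂ := fun p => if G.IsInner A (G.endVertex ((p.1 : E), p.2)) then 0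
    else F₁ p.1 (G.endCoord ((p.1 : E), p.2))
  have hzero : ∀ p : A × Bool, ¬ G.IsInner A (G.endVertex ((p.1 : E), p.2)) →
      F p.1 (G.endCoord ((p.1 : E), p.2)) = 0 := by
    intro p hp
    refine hbc.2 _ ⟨⟨((p.1 : E), p.2), rfl, p.1.2⟩, ?_⟩ ⟨((p.1 : E), p.2), rfl⟩ p.1.2
    unfold MetricGraph.IsInner at hp
    push Not at hp
    exact hp
  have hc : ∀ p, c p ≠ 0 → F p.1 (G.endCoord ((p.1 : E), p.2)) = 0 := fun p hp =>
    hzero p fun hi => hp (if_pos hi)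
  choose K hK0 hK using fun e : A => (h e).exists_cutoff (G.len_pos e) (c₀ := c (e, false))
    (c₁ := c (e, true)) (hc (e, false)) (hc (e, true))
  refine ⟨∑ e, K e, fun ε hε hεu => ?_⟩
  choose θ θ₁ θ₂ Θ Θ₁ hr z0 z1 z2 z3 hn hi using fun e : A =>
    hK e ε hε (hεu.trans_le (hG.2.2 e).1)
  have hcoord : ∀ p : A × Bool, Θ p.1 (G.endCoord ((p.1 : E), p.2)) = 0 ∧
      Θ₁ p.1 (G.endCoord ((p.1 : E), p.2)) = c p := by
    rintro ⟨e, b⟩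
    cases b
    · exact ⟨z0 e, z2 e⟩
    · exact ⟨z1 e, z3 e⟩
  refine ⟨⟨θ, Memℓp.all _⟩, ⟨θ₁, Memℓp.all _⟩, ⟨θ₂, Memℓp.all _⟩,
    fun e t => F e t - Θ e t, fun e t => F₁ e t - Θ₁ e t, fun e => (h e).sub (hr e),
    hbc.congr (fun p => ?_) (fun p hp => ?_), fun p hp => ⟨?_, ?_⟩, ?_, ?_⟩
  · rw [(hcoord p).1, sub_zero]
  · rw [(hcoord p).2, show c p = 0 from if_pos hp, sub_zero]
  · beta_reduce
    rw [(hcoord p).1, sub_zero, hzero p hp]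
  · beta_reduce
    rw [(hcoord p).2, show c p = _ from if_neg hp, sub_self]
  · refine le_of_sq_le_sq ?_ (mul_nonneg (Finset.sum_nonneg fun e _ => hK0 e) hε.le)
    rw [norm_sq_eq_sum, mul_pow]
    calc ∑ e, ‖θ e‖ ^ 2 ≤ ∑ e, (K e * ε) ^ 2 :=
          Finset.sum_le_sum fun e _ => pow_le_pow_left₀ (norm_nonneg _) (hn e) 2
      _ = (∑ e, K e ^ 2) * ε ^ 2 := by rw [Finset.sum_mul]; simp only [mul_pow]
      _ ≤ (∑ e, K e) ^ 2 * ε ^ 2 := by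
          gcongr
          exact Finset.sum_sq_le_sq_sum_of_nonneg fun e _ => hK0 e
  · have hs := lp.hasSum_inner (𝕜 := ℂ) (f - ⟨θ, Memℓp.all _⟩ : G.L2 A) ⟨θ₂, Memℓp.all _⟩
    rw [← hs.tsum_eq, tsum_fintype, Finset.sum_mul]
    exact (norm_sum_le _ _).trans (Finset.sum_le_sum fun e _ => hi e)

/-- The operators on finite subgraphs are bounded below by the ground state energy. -/
theorem groundEnergy_mul_le_of_finite [Finite A] {u U : ℝ} (hG : G.LengthBounds u U)
    {ν : E → ℝ → ℝ} {cm cp : ℝ} (hν : IsSingleSite G ν cm cp) {qm : ℝ} {f g : G.L2 A}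
    (h : (f, g) ∈ operatorGraph G bc ν (fun _ => qm) A) :
    groundEnergy G bc ν qm * ‖f‖ ^ 2 ≤ (⟪f, g⟫_ℂ).re := by
  obtain ⟨f₁, f₂, F, F₁, hr, hbc, hg⟩ := mem_operatorGraph_iff.1 h
  obtain ⟨K, hK⟩ := hr.exists_approximation hG hbc
  have hcp : 0 ≤ cp := hν.1.le.trans hν.2.1
  obtain ⟨W, -, hW⟩ := exists_mulOperator (A := A) (w := fun e t => qm * ν e t)
    (Q := |qm| * cp) (by positivity) (fun e => (hν.2.2 e).1.const_mul _)
    (fun e _ => ae_abs_mul_le hν le_rfl e)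
  have hu := hG.1
  have hεp : ∀ n : ℕ, 0 < u / (n + 2) := fun n => by positivity
  choose θ θ₁ θ₂ Θ Θ₁ hr' hbc' hz hn hi using fun n : ℕ => hK (u / (n + 2)) (hεp n)
    (div_lt_self hu (by linarith [(n.cast_nonneg : (0 : ℝ) ≤ n)]))
  have hε : Tendsto (fun n : ℕ => K * (u / ((n : ℝ) + 2))) atTop (𝓝 0) := by
    have h1 : Tendsto (fun n : ℕ => u / ((n : ℝ) + 2)) atTop (𝓝 0) :=
      tendsto_const_nhds.div_atTop
        (tendsto_atTop_add_const_right _ _ tendsto_natCast_atTop_atTop)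
    simpa using h1.const_mul K
  have tθ : Tendsto θ atTop (𝓝 0) := squeeze_zero_norm hn hε
  have ti : Tendsto (fun n => ⟪f - θ n, θ₂ n⟫_ℂ) atTop (𝓝 0) := squeeze_zero_norm hi hε
  have tf : Tendsto (fun n => f - θ n) atTop (𝓝 f) := by simpa using tθ.const_sub f
  -- The operator maps `f - θ` to `g - W θ + θ''`. The first two terms converge to `g` in norm. The
  -- term `θ''` need not be small in norm, but its pairing with `f - θ` is.
  have key : ∀ n, groundEnergy G bc ν qm * ‖f - θ n‖ ^ 2 ≤
      (⟪f - θ n, g - W (θ n)⟫_ℂ + ⟪f - θ n, θ₂ n⟫_ℂ).re := by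
    intro n
    have hmem := extendL2_mem_operatorGraph (q := fun _ => qm) (ν := ν)
      (k := g - W (θ n) + θ₂ n) (hr' n) (hbc' n) (hz n) (fun e => by
        filter_upwards [hg e, hW (θ n) e, Lp.coeFn_add (g e - W (θ n) e) (θ₂ n e),
          Lp.coeFn_sub (g e) (W (θ n) e), Lp.coeFn_sub (f₂ e) (θ₂ n e),
          Lp.coeFn_sub (f e) (θ n e)] with t e1 e2 e3 e4 e5 e6
        have e3' : ((g - W (θ n) + θ₂ n) e : ℝ → ℂ) t = g e t - W (θ n) e t + θ₂ n e t := by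
          refine Eq.trans e3 ?_
          rw [Pi.add_apply, e4, Pi.sub_apply]
        have e5' : ((f₂ - θ₂ n) e : ℝ → ℂ) t = f₂ e t - θ₂ n e t := e5
        have e6' : ((f - θ n) e : ℝ → ℂ) t = f e t - θ n e t := e6
        have e1' : (g e : ℝ → ℂ) t = -f₂ e t + ((qm * ν e t : ℝ) : ℂ) * f e t := e1
        rw [e3', e5', e6', e2, e1']
        ring)
    have := groundEnergy_mul_le hG hν hmem
    rwa [inner_extendL2, ← re_inner_self (extendL2 G A (f - θ n)), inner_extendL2,
      re_inner_self, inner_add_right] at this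
  have tW : Tendsto (fun n => g - W (θ n)) atTop (𝓝 g) := by
    have := (W.continuous.tendsto 0).comp tθ
    rw [map_zero] at this
    simpa using this.const_sub g
  have t1 : Tendsto (fun n => groundEnergy G bc ν qm * ‖f - θ n‖ ^ 2) atTop
      (𝓝 (groundEnergy G bc ν qm * ‖f‖ ^ 2)) := (tf.norm.pow 2).const_mul _
  have t2 : Tendsto (fun n => (⟪f - θ n, g - W (θ n)⟫_ℂ + ⟪f - θ n, θ₂ n⟫_ℂ).re) atTop
      (𝓝 (⟪f, g⟫_ℂ).re) := by
    have := (Complex.continuous_re.tendsto _).comp ((tf.inner tW).add ti)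
    rwa [add_zero] at this
  exact le_of_tendsto_of_tendsto' t1 t2 key

end Extend

/-! ### The initial length scale estimate -/

section Estimate

variable {E V : Type*} {G : MetricGraph E V} {bc : BoundaryCondition G} {A : Set E}

theorem mul_norm_sq_le_re_inner_Lp {μ : Measure ℝ} {f k : Lp ℂ 2 μ} {w : ℝ → ℝ} {c : ℝ}
    (hc : ∀ᵐ t ∂μ, c ≤ w t) (hk : ∀ᵐ t ∂μ, k t = (w t : ℂ) * f t) :
    c * ‖f‖ ^ 2 ≤ (⟪f, k⟫_ℂ).re := by
  have e1 : (⟪f, k⟫_ℂ).re = ∫ t, (⟪f t, k t⟫_ℂ).re ∂μ := by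
    rw [L2.inner_def]; exact (integral_re (L2.integrable_inner (𝕜 := ℂ) f k)).symm
  have e2 : ‖f‖ ^ 2 = ∫ t, (⟪f t, f t⟫_ℂ).re ∂μ := by
    rw [← re_inner_self, L2.inner_def]
    exact (integral_re (L2.integrable_inner (𝕜 := ℂ) f f)).symm
  rw [e1, e2, ← integral_const_mul]
  refine integral_mono_ae ((L2.integrable_inner (𝕜 := ℂ) f f).re.const_mul c)
    (L2.integrable_inner (𝕜 := ℂ) f k).re ?_
  filter_upwards [hc, hk] with t h1 h2
  change c * (⟪f t, f t⟫_ℂ).re ≤ (⟪f t, k t⟫_ℂ).re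
  have e : (⟪f t, (w t : ℂ) * f t⟫_ℂ).re = w t * (⟪f t, f t⟫_ℂ).re := by
    rw [← smul_eq_mul (w t : ℂ) (f t), inner_smul_right, Complex.re_ofReal_mul]
  rw [h2, e]
  have e0 : 0 ≤ RCLike.re ⟪f t, f t⟫_ℂ := inner_self_nonneg
  exact mul_le_mul_of_nonneg_right h1 e0

/-- If all coupling constants exceed `qm` by `h`, the quadratic form is bounded below by
`λ₀ + cm h`. -/
theorem re_inner_ge_of_coupling_ge [Finite A] {u U : ℝ} (hG : G.LengthBounds u U)
    {ν : E → ℝ → ℝ} {cm cp : ℝ} (hν : IsSingleSite G ν cm cp) {qm h Q : ℝ} (hh : 0 ≤ h)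
    {ω : E → ℝ} (hω : ∀ e ∈ A, qm + h ≤ ω e) (hωQ : ∀ e, |ω e - qm| ≤ Q) {f g : G.L2 A}
    (hfg : (f, g) ∈ operatorGraph G bc ν ω A) :
    (groundEnergy G bc ν qm + cm * h) * ‖f‖ ^ 2 ≤ (⟪f, g⟫_ℂ).re := by
  obtain ⟨f₁, f₂, F, F₁, hr, hbc, hg⟩ := mem_operatorGraph_iff.1 hfg
  have hcp : 0 ≤ cp := hν.1.le.trans hν.2.1
  rcases isEmpty_or_nonempty A with hA | ⟨⟨e₀, -⟩⟩
  · have : f = 0 := lp.ext (funext fun e => (hA.false e).elim)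
    simp [this]
  have hQ0 : 0 ≤ Q := (abs_nonneg _).trans (hωQ e₀)
  obtain ⟨W, -, hW⟩ := exists_mulOperator (A := A) (w := fun e t => (ω e - qm) * ν e t)
    (Q := Q * cp) (by positivity) (fun e => (hν.2.2 e).1.const_mul _)
    (fun e _ => ae_abs_mul_le hν (hωQ e) e)
  -- Domain and boundary conditions do not depend on the coupling constants, so removing the excess
  -- potential `W` leaves the operator with coupling `qm`.
  have hmem : (f, g - W f) ∈ operatorGraph G bc ν (fun _ => qm) A := by
    refine mem_operatorGraph_iff.2 ⟨f₁, f₂, F, F₁, hr, hbc, fun e => ?_⟩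
    filter_upwards [hg e, hW f e, Lp.coeFn_sub (g e) (W f e)] with t e1 e2 e3
    have e1' : (g e : ℝ → ℂ) t = -f₂ e t + ((ω e * ν e t : ℝ) : ℂ) * f e t := e1
    have e3' : ((g - W f) e : ℝ → ℂ) t = g e t - W f e t := e3
    rw [e3', e1', e2]
    push_cast
    ring
  have h1 := groundEnergy_mul_le_of_finite hG hν hmem
  have h2 : cm * h * ‖f‖ ^ 2 ≤ (⟪f, W f⟫_ℂ).re := by
    have := Fintype.ofFinite A
    have hs := (lp.hasSum_inner (𝕜 := ℂ) f (W f)).mapL Complex.reCLM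
    have hs' : (⟪f, W f⟫_ℂ).re = ∑ e, (⟪f e, W f e⟫_ℂ).re := by
      rw [← tsum_fintype (L := .unconditional A)]; exact hs.tsum_eq.symm
    rw [norm_sq_eq_sum, hs', Finset.mul_sum]
    refine Finset.sum_le_sum fun e _ => mul_norm_sq_le_re_inner_Lp ?_ (hW f e)
    filter_upwards [(hν.2.2 e).2] with t ht
    have : h ≤ ω e - qm := by linarith [hω e e.2]
    rw [mul_comm]
    exact mul_le_mul this ht.1 hν.1.le (hh.trans this)
  rw [inner_sub_right, Complex.sub_re] at h1
  linarith

theorem finite_of_vol_ne_top {u U : ℝ} (hG : G.LengthBounds u U) (hA : G.vol A ≠ ⊤) :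
    Finite A := by
  have h := ENNReal.finite_const_le_of_tsum_ne_top hA
    (ε := ENNReal.ofReal u) (by simpa using hG.1)
  refine Set.finite_univ_iff.1 (h.subset fun e _ => ?_)
  exact ENNReal.ofReal_le_ofReal (hG.2.2 e).1

/-- Each edge contributes at least `u` to the volume, so there are at most `v / u` edges. -/
theorem tsum_const_le_of_vol_le {u U v : ℝ} (hG : G.LengthBounds u U)
    (hA : G.vol A ≤ ENNReal.ofReal v) {c : ℝ} (hc : 0 ≤ c) :
    ∑' _ : A, ENNReal.ofReal c ≤ ENNReal.ofReal (v / u * c) := by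
  have hu := hG.1
  have h1 : ∑' _ : A, ENNReal.ofReal c ≤ ENNReal.ofReal (c / u) * G.vol A := by
    unfold MetricGraph.vol
    rw [← ENNReal.tsum_mul_left]
    refine ENNReal.tsum_le_tsum fun e => ?_
    rw [← ENNReal.ofReal_mul (by positivity)]
    refine ENNReal.ofReal_le_ofReal ?_
    have := (hG.2.2 e).1
    calc c = c / u * u := by field_simp
      _ ≤ c / u * G.len e := by gcongr
  refine h1.trans ((mul_le_mul_right hA _).trans ?_)
  rw [← ENNReal.ofReal_mul (by positivity)]
  exact ENNReal.ofReal_le_ofReal (le_of_eq (by ring))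

/-- The ground state energy is close to the spectrum only if some coupling constant is small. -/
theorem exists_coupling_le_of_infEDist_le [Finite A] {u U : ℝ} (hG : G.LengthBounds u U)
    {ν : E → ℝ → ℝ} {cm cp : ℝ} (hν : IsSingleSite G ν cm cp) {qm qp a : ℝ} (ha : 0 < a)
    {ω : E → ℝ} (hω : ∀ e, ω e ∈ Set.Icc qm qp)
    (hd : Metric.infEDist (groundEnergy G bc ν qm : ℂ) (opSpectrum (operatorGraph G bc ν ω A)) ≤
      ENNReal.ofReal a) : ∃ e ∈ A, ω e ∈ Set.Icc qm (qm + 2 / cm * a) := by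
  by_contra hcon
  push Not at hcon
  have hcm := hν.1
  have hlow : ∀ fg ∈ operatorGraph G bc ν ω A,
      (groundEnergy G bc ν qm + cm * (2 / cm * a)) * ‖fg.1‖ ^ 2 ≤ (⟪fg.1, fg.2⟫_ℂ).re := by
    rintro ⟨f, g⟩ hfg
    refine re_inner_ge_of_coupling_ge hG hν (Q := qp - qm) (by positivity) (fun e he => ?_)
      (fun e => ?_) hfg
    · by_contra hlt
      exact hcon e he ⟨(hω e).1, (not_le.1 hlt).le⟩
    · have h1 := (hω e).1
      have h2 := (hω e).2
      rw [abs_of_nonneg (by linarith)]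
      linarith
  have hQ : ∀ e, |ω e| ≤ max |qm| |qp| := fun e => abs_le_max_abs_abs (hω e).1 (hω e).2
  have hcp : 0 ≤ cp := hcm.le.trans hν.2.1
  -- The factor `2` in the threshold `2 / cm * a` gives a gap of `2 * a`, which strictly exceeds the
  -- closed distance condition `≤ a`.
  have hfar : ENNReal.ofReal (2 * a) ≤
      Metric.infEDist (groundEnergy G bc ν qm : ℂ) (opSpectrum (operatorGraph G bc ν ω A)) := by
    rw [Metric.le_infEDist]
    intro z hz
    have hre : groundEnergy G bc ν qm + cm * (2 / cm * a) ≤ z.re := by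
      by_contra hlt
      exact notMem_opSpectrum_operatorGraph hG (fun e => (hν.2.2 e).1)
        (Q := max |qm| |qp| * cp) (by positivity) (fun e _ => ae_abs_mul_le hν (hQ e) e)
        hlow (not_le.1 hlt) hz
    rw [edist_dist]
    refine ENNReal.ofReal_le_ofReal ?_
    have e1 : cm * (2 / cm * a) = 2 * a := by field_simp
    have h1 : z.re - groundEnergy G bc ν qm ≤ dist (groundEnergy G bc ν qm : ℂ) z := by
      rw [dist_comm, dist_eq_norm]
      have := Complex.re_le_norm (z - (groundEnergy G bc ν qm : ℂ))
      simpa using this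
    linarith
  have := (ENNReal.ofReal_le_ofReal_iff ha.le).1 (hfar.trans hd)
  linarith

/-- Union bound; each coordinate of the product measure has distribution `μ`. -/
theorem measure_exists_coupling_le (μ : Measure ℝ) [IsProbabilityMeasure μ] [Countable A]
    (a b : ℝ) : Measure.infinitePi (fun _ : E => μ) {ω | ∃ e ∈ A, ω e ∈ Set.Icc a b} ≤
      ∑' _ : A, μ (Set.Icc a b) := by
  have hsub : {ω : E → ℝ | ∃ e ∈ A, ω e ∈ Set.Icc a b} ⊆
      ⋃ e : A, (fun ω : E → ℝ => ω e) ⁻¹' Set.Icc a b := by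
    rintro ω ⟨e, he, h⟩
    exact Set.mem_iUnion.2 ⟨⟨e, he⟩, h⟩
  refine (measure_mono hsub).trans ((measure_iUnion_le _).trans (le_of_eq (tsum_congr fun e => ?_)))
  exact (measurePreserving_eval_infinitePi (fun _ : E => μ) (e : E)).measure_preimage
    measurableSet_Icc.nullMeasurableSet

/-- The exponent `β` is chosen such that `τ β < s`. -/
theorem exists_exponent (τ : ℝ) {s : ℝ} (hs : 0 < s) : ∃ β : ℝ, 0 < β ∧ β < 2 ∧ τ * β < s := by
  have hpos : 0 < |τ| + 1 := by positivity
  -- The `1` keeps `β` below `2`, and `|τ| + 1` makes the choice independent of the sign of `τ`.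
  refine ⟨min 1 (s / (|τ| + 1)), lt_min one_pos (by positivity),
    (min_le_left _ _).trans_lt one_lt_two, ?_⟩
  have h1 : 0 < min 1 (s / (|τ| + 1)) := lt_min one_pos (by positivity)
  calc τ * min 1 (s / (|τ| + 1)) ≤ |τ| * min 1 (s / (|τ| + 1)) := by gcongr; exact le_abs_self τ
    _ < (|τ| + 1) * min 1 (s / (|τ| + 1)) := by gcongr; linarith
    _ ≤ (|τ| + 1) * (s / (|τ| + 1)) := by gcongr; exact min_le_right _ _
    _ = s := by field_simp

/-- The left side is a constant times `r ^ (d + (β - 2) * τ)`. By the choice of `β` this exponent is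
strictly below `-ξ`, and the surplus negative power beats the constant. -/
theorem eventually_rpow_bound {d τ ξ β : ℝ} (hβ : τ * β < 2 * τ - d - ξ) (C u : ℝ) {c : ℝ}
    (hc : 0 < c) :
    ∀ᶠ r : ℝ in atTop, C * r ^ d / u * (c * r ^ (β - 2)) ^ τ ≤ r ^ (-ξ) := by
  have ht : Tendsto (fun r : ℝ => C / u * c ^ τ * r ^ (-(2 * τ - d - ξ - τ * β))) atTop (𝓝 0) := by
    simpa using (tendsto_rpow_neg_atTop (sub_pos.2 hβ)).const_mul (C / u * c ^ τ)
  filter_upwards [ht.eventually_le_const one_pos, eventually_gt_atTop 0] with r hr hr0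
  have e : C * r ^ d / u * (c * r ^ (β - 2)) ^ τ =
      (C / u * c ^ τ * r ^ (-(2 * τ - d - ξ - τ * β))) * r ^ (-ξ) := by
    rw [Real.mul_rpow hc.le (by positivity), ← Real.rpow_mul hr0.le, mul_assoc _ (r ^ _) (r ^ _),
      ← Real.rpow_add hr0, show -(2 * τ - d - ξ - τ * β) + -ξ = d + (β - 2) * τ by ring,
      Real.rpow_add hr0]
    ring
  rw [e]
  exact mul_le_of_le_one_left (by positivity) hr

end Estimate

end QGraph

end

theorem mainTheorem7 (d τ ξ : ℝ) (hξ : ξ ∈ Set.Ioo 0 (2 * τ - d)) :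
    ∃ β : ℝ, 0 < β ∧
      ∀ (E V : Type*) [Countable E] [Countable V] [Infinite E]
        (G : QGraph.MetricGraph E V) (_ : G.Connected) (_ : G.NoIsolated)
        (u U C : ℝ) (_ : G.LengthBounds u U) (_ : G.PolyGrowth u C d)
        (bc : QGraph.BoundaryCondition G)
        (μ : Measure ℝ) [IsProbabilityMeasure μ] (qm qp : ℝ)
        (_ : QGraph.HasBoundedDensity μ qm qp)
        (ν : E → ℝ → ℝ) (cm cp : ℝ) (_ : QGraph.IsSingleSite G ν cm cp)
        (_ : QGraph.Disorder μ qm d τ),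
        ∃ r₁ : ℝ, 300 * U ≤ r₁ ∧ ∀ (v : V) (r : ℝ), r₁ ≤ r →
          Measure.infinitePi (fun _ : E => μ)
              {ω | (∀ e, ω e ∈ Set.Icc qm qp) ∧
                Metric.infEDist (QGraph.groundEnergy G bc ν qm : ℂ)
                    (QGraph.ballSpectrum G bc ν ω v r) ≤ ENNReal.ofReal (r ^ (β - 2))}
            ≤ ENNReal.ofReal (r ^ (-ξ)) := by
  obtain ⟨β, hβ0, hβ2, hβ⟩ := QGraph.exists_exponent τ (s := 2 * τ - d - ξ) (by linarith [hξ.2])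
  refine ⟨β, hβ0, ?_⟩
  intro E V _ _ _ G _ _ u U C hG hgrowth bc μ _ qm qp _ ν cm cp hν hdis
  have hcm := hν.1
  have hcpos : 0 < 2 / cm := by positivity
  -- As `β < 2`, the threshold for the coupling constants tends to `0` from the right, so the
  -- disorder bound applies for large `r`.
  have hlim : Tendsto (fun r : ℝ => 2 / cm * r ^ (β - 2)) atTop (𝓝[>] 0) := by
    refine tendsto_nhdsWithin_iff.2 ⟨?_, ?_⟩
    · have := (tendsto_rpow_neg_atTop (y := 2 - β) (by linarith)).const_mul (2 / cm)
      simpa using this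
    · filter_upwards [eventually_gt_atTop 0] with r hr
      exact mul_pos hcpos (Real.rpow_pos_of_pos hr _)
  -- These conditions depend on `r` only, so the resulting radius is uniform in `v`; `r ≥ u` is what
  -- the growth hypothesis requires.
  have hev := (hlim.eventually hdis.2).and
    ((QGraph.eventually_rpow_bound hβ C u hcpos).and
      ((eventually_ge_atTop u).and (eventually_gt_atTop 0)))
  obtain ⟨r₀, hr₀⟩ := eventually_atTop.1 hev
  refine ⟨max r₀ (300 * U), le_max_right _ _, fun v r hr => ?_⟩
  obtain ⟨h1, h2, h3, h4⟩ := hr₀ r ((le_max_left _ _).trans hr)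
  have hvol := hgrowth v r h3
  have hfin := QGraph.finite_of_vol_ne_top hG (ne_top_of_le_ne_top ENNReal.ofReal_ne_top hvol)
  refine (measure_mono ?_).trans ((QGraph.measure_exists_coupling_le (A := G.ballEdges v r) μ qm
    (qm + 2 / cm * r ^ (β - 2))).trans ?_)
  · rintro ω ⟨hω, hd⟩
    exact QGraph.exists_coupling_le_of_infEDist_le hG hν (Real.rpow_pos_of_pos h4 _) hω hd
  · refine (ENNReal.tsum_le_tsum fun _ => h1).trans ?_
    exact (QGraph.tsum_const_le_of_vol_le hG hvol (by positivity)).trans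
      (ENNReal.ofReal_le_ofReal h2)
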